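/- Let $n\ge 2$ and let $C_0>0$. There is a constant $C>0$, depending only on $n$ and $C_0$, with the following property. Let $\lambda>1$, let $0<r_0<1$, let $u$ be a real function of class $C^4$ on an open set $U\subseteq\mathbb R^n$ containing the closed ball $\overline{B}_{r_0}(0)\subseteq\mathbb R^n$, and suppose that $\Delta^2u=\lambda^2u$ in the ball $B_{r_0}(0)\subseteq\mathbb R^n$. Put $v=\Delta u-\lambda u$ and, for $y=(x,x_{n+1})$ with $x\in U$ and $x_{n+1}\in\mathbb R$, $$g(y)=u(x)e^{\sqrt\lambda\,x_{n+1}},\qquad h(y)=v(x)e^{\sqrt\lambda\,x_{n+1}}.$$ For $y_0\in\mathbb R^{n+1}$ and $r>0$ with $\overline{B}_r(y_0)\subseteq U\times\mathbb R$ define the frequency centered at $y_0$ by $$N(y_0,r)=r\,\frac{\int_{B_r(y_0)}\left(|\nabla g|^2+|\nabla h|^2+gh+2\lambda g^2\right)dy}{\int_{\partial B_r(y_0)}\left(g^2+h^2\right)d\sigma},$$ where the balls are balls of $\mathbb R^{n+1}$ and $d\sigma$ is the $n$-dimensional surface measure (and $N(y_0,r)=0$ if the denominator vanishes). Then for every $p\in\mathbb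 R^{n+1}$ with $|p|<r_0/4$ and every $\rho$ with $0<\rho\le\frac12(r_0-|p|)$, $$N(p,\rho)\le C\max\{N(0,r_0),C_0\}.$$ In particular, if $C_0$ is a positive constant depending only on $n$, then $C$ depends only on $n$. -/

import Mathlib

open scoped Gradient Laplacian

noncomputable section

namespace BiharmonicFrequency

/-- The surface measure `dσ` on the sphere `∂B_r(y₀) ⊆ ℝᵐ` (`m ≥ 1`, `r > 0`), as a measure on `ℝᵐ`: the image
of Mathlib's surface measure on the unit sphere under `ω ↦ y₀ + r ω`, scaled by `r ^ (m - 1)`.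
This is the `(m - 1)`-dimensional Hausdorff measure on the sphere in its usual normalization
(Mathlib's `μH[m - 1]` omits the normalizing constant). It is used with `m = n + 1`. -/
def sphereMeasure {m : ℕ} (y₀ : EuclideanSpace ℝ (Fin m)) (r : ℝ) :
    MeasureTheory.Measure (EuclideanSpace ℝ (Fin m)) :=
  ENNReal.ofReal (r ^ (m - 1)) •
    (MeasureTheory.Measure.toSphere
        (MeasureTheory.volume : MeasureTheory.Measure (EuclideanSpace ℝ (Fin m)))).map
      (fun ω : Metric.sphere (0 : EuclideanSpace ℝ (Fin m)) 1 =>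
        y₀ + r • (ω : EuclideanSpace ℝ (Fin m)))

/-- The projection `y = (x, x_{n+1}) ↦ x`. -/
def horizontal {n : ℕ} (y : EuclideanSpace ℝ (Fin (n + 1))) : EuclideanSpace ℝ (Fin n) :=
  WithLp.toLp 2 (fun i => y i.castSucc)

/-- `f(x) ↦ f(x) e^{√lam x_{n+1}}`, a function on `ℝⁿ⁺¹`. -/
def expLift {n : ℕ} (lam : ℝ) (f : EuclideanSpace ℝ (Fin n) → ℝ)
    (y : EuclideanSpace ℝ (Fin (n + 1))) : ℝ :=
  f (horizontal y) * Real.exp (Real.sqrt lam * y (Fin.last n))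

/-- `v = Δu - lam u`. -/
def auxV {n : ℕ} (lam : ℝ) (u : EuclideanSpace ℝ (Fin n) → ℝ)
    (x : EuclideanSpace ℝ (Fin n)) : ℝ :=
  (Δ u) x - lam * u x

/-- `g(x, x_{n+1}) = u(x) e^{√lam x_{n+1}}`. -/
def g {n : ℕ} (lam : ℝ) (u : EuclideanSpace ℝ (Fin n) → ℝ) :
    EuclideanSpace ℝ (Fin (n + 1)) → ℝ :=
  expLift lam u

/-- `h(x, x_{n+1}) = v(x) e^{√lam x_{n+1}}` with `v = Δu - lam u`. -/
def h {n : ℕ} (lam : ℝ) (u : EuclideanSpace ℝ (Fin n) → ℝ) :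
    EuclideanSpace ℝ (Fin (n + 1)) → ℝ :=
  expLift lam (auxV lam u)

/-- `D(y₀, r) = ∫_{B_r(y₀)} (|∇g|² + |∇h|² + g h + 2 lam g²) dy`. -/
def D {n : ℕ} (lam : ℝ) (u : EuclideanSpace ℝ (Fin n) → ℝ)
    (y₀ : EuclideanSpace ℝ (Fin (n + 1))) (r : ℝ) : ℝ :=
  ∫ y in Metric.ball y₀ r,
    (‖∇ (g lam u) y‖ ^ 2 + ‖∇ (h lam u) y‖ ^ 2 + g lam u y * h lam u y + 2 * lam * g lam u y ^ 2)

/-- `H(y₀, r) = ∫_{∂B_r(y₀)} (g² + h²) dσ`. -/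
def H {n : ℕ} (lam : ℝ) (u : EuclideanSpace ℝ (Fin n) → ℝ)
    (y₀ : EuclideanSpace ℝ (Fin (n + 1))) (r : ℝ) : ℝ :=
  ∫ y, (g lam u y ^ 2 + h lam u y ^ 2) ∂(sphereMeasure y₀ r)

/-- The frequency `N(y₀, r) = r D(y₀, r) / H(y₀, r)`. -/
def N {n : ℕ} (lam : ℝ) (u : EuclideanSpace ℝ (Fin n) → ℝ)
    (y₀ : EuclideanSpace ℝ (Fin (n + 1))) (r : ℝ) : ℝ :=
  r * (D lam u y₀ r / H lam u y₀ r)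

end BiharmonicFrequency

end

/-! Write `m = n + 1`. Multiplying by `e^{√λ x_{n+1}}` turns the fourth order equation into the
second order system `Δg = h + 2λg`, `Δh = 0` (`coupledSystem`). The numerator `D` of the frequency
is then the integral of `|∇g|² + gΔg + |∇h|² + hΔh`, so Green's formula makes it a boundary integral
and `H' = (m - 1)/r · H + 2D`.

As in Almgren's argument, a Rellich–Pohozaev identity gives a lower bound for `D'`, and
Cauchy–Schwarz on the sphere compares it with `D²/H`. The terms left over have no counterpart for
harmonic functions. They are bounded by `D` and `H` uniformly in `λ`: the dangerous ones cancel or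
are absorbed by `2λg²`, and `∫ h²` is controlled by `H` because `h` is harmonic. Hence `e^r (N + m)`
is nondecreasing for `r ≤ 1` wherever `H > 0` (`CoupledSystem.frequency_add_le`).

Since `H` is itself nondecreasing, integrals over balls and spheres are comparable. A bound on `N(0,
r₀)` gives doubling of `H` about `0`; inclusions of balls carry this to the centre `p`. If `N(p, ·)`
were large at a middle radius, `H(p, ·)` would grow faster than that allows
(`CoupledSystem.frequency_le_of_center`). The result is a bound affine in `N(0, r₀)`, and the
maximum with `C₀` absorbs its constant term. -/

set_option linter.unusedSectionVars false

/-! ### Polar coordinates and the divergence theorem on balls. -/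

section BallCalculus

open MeasureTheory Metric Set Module

variable {E : Type*} [NormedAddCommGroup E] [InnerProductSpace ℝ E] [FiniteDimensional ℝ E]
  [MeasurableSpace E] [BorelSpace E] [Nontrivial E]

/-- Integration in polar coordinates. -/
theorem integral_eq_integral_Ioi_toSphere (μ : Measure E) [μ.IsAddHaarMeasure] {f : E → ℝ}
    (hf : Integrable f μ) :
    ∫ x, f x ∂μ = ∫ t in Ioi (0 : ℝ), t ^ (finrank ℝ E - 1) *
      ∫ ω : sphere (0 : E) 1, f (t • (ω : E)) ∂μ.toSphere := by
  have hmp := μ.measurePreserving_homeomorphUnitSphereProd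
  have hemb := (homeomorphUnitSphereProd E).measurableEmbedding
  set F : sphere (0 : E) 1 × Ioi (0 : ℝ) → ℝ := fun z => f ((z.2 : ℝ) • (z.1 : E)) with hF
  have hFe : ∀ x : ({0}ᶜ : Set E), F (homeomorphUnitSphereProd E x) = f x := by
    intro x
    have hx : (x : E) ≠ 0 := x.2
    simp [hF, homeomorphUnitSphereProd, smul_smul, mul_inv_cancel₀ (norm_ne_zero_iff.2 hx)]
  have hFi : Integrable F (μ.toSphere.prod (.volumeIoiPow (finrank ℝ E - 1))) := by
    rw [← hmp.integrable_comp_emb hemb]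
    have h1 : Integrable (fun x : ({0}ᶜ : Set E) => f x) (μ.comap (↑)) := by
      have := (integrableOn_iff_comap_subtypeVal (μ := μ) (f := f)
        (measurableSet_singleton (0 : E)).compl).1 hf.integrableOn
      exact this
    exact h1.congr (Filter.Eventually.of_forall fun x => (hFe x).symm)
  calc
    ∫ x, f x ∂μ = ∫ x : ({(0)}ᶜ : Set E), f x ∂(μ.comap (↑)) := by
      rw [integral_subtype_comap (measurableSet_singleton _).compl f,
        restrict_compl_singleton]
    _ = ∫ z, F z ∂μ.toSphere.prod (.volumeIoiPow (finrank ℝ E - 1)) := by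
      rw [← hmp.integral_comp hemb]
      exact integral_congr_ae (Filter.Eventually.of_forall fun x => (hFe x).symm)
    _ = ∫ t : Ioi (0 : ℝ), (∫ ω, F (ω, t) ∂μ.toSphere) ∂.volumeIoiPow (finrank ℝ E - 1) :=
      integral_prod_symm _ hFi
    _ = _ := by
      simp only [Measure.volumeIoiPow, ENNReal.ofReal]
      rw [integral_withDensity_eq_integral_smul,
        integral_subtype_comap measurableSet_Ioi
          fun a ↦ Real.toNNReal (a ^ (finrank ℝ E - 1)) • ∫ ω : sphere (0 : E) 1, f (a • (ω : E)) ∂μ.toSphere,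
        setIntegral_congr_fun measurableSet_Ioi fun x hx ↦ ?_]
      · simp only [NNReal.smul_def, Real.coe_toNNReal _ (pow_nonneg hx.out.le _), smul_eq_mul]
      · exact (measurable_subtype_coe.pow_const _).real_toNNReal

/-- The integral of `f` over the sphere of centre `p` and radius `r`. -/
noncomputable def surfInt (μ : Measure E) (f : E → ℝ) (p : E) (r : ℝ) : ℝ :=
  r ^ (finrank ℝ E - 1) * ∫ ω : sphere (0 : E) 1, f (p + r • (ω : E)) ∂μ.toSphere

variable (μ : Measure E) [μ.IsAddHaarMeasure]

theorem continuous_surfInt {f : E → ℝ} (hf : Continuous f) (p : E) :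
    Continuous (surfInt μ f p) := by
  unfold surfInt
  refine (continuous_pow _).mul ?_
  have : Continuous (fun z : ℝ × sphere (0 : E) 1 => f (p + z.1 • (z.2 : E))) := by fun_prop
  simpa using continuous_parametric_integral_of_continuous (μ := μ.toSphere) (s := univ) this isCompact_univ

theorem integrable_sphere {f : E → ℝ} (hf : Continuous f) (p : E) (r : ℝ) :
    Integrable (fun ω : sphere (0 : E) 1 => f (p + r • (ω : E))) μ.toSphere := by
  have : Continuous (fun ω : sphere (0 : E) 1 => f (p + r • (ω : E))) := by fun_prop
  exact this.integrable_of_hasCompactSupport (HasCompactSupport.of_compactSpace _)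

theorem integrableOn_ball_of_continuous {f : E → ℝ} (hf : Continuous f) (p : E) (r : ℝ) :
    IntegrableOn f (ball p r) μ :=
  (hf.continuousOn.integrableOn_compact (isCompact_closedBall p r)).mono_set ball_subset_closedBall

theorem setIntegral_ball_eq {f : E → ℝ} (hf : Continuous f) (p : E) {r : ℝ} (hr : 0 ≤ r) :
    ∫ x in ball p r, f x ∂μ = ∫ t in (0)..r, surfInt μ f p t := by
  have h1 : ∫ x in ball p r, f x ∂μ = ∫ x, (ball (0 : E) r).indicator (fun x => f (p + x)) x ∂μ := by
    rw [← integral_indicator measurableSet_ball, ← integral_add_left_eq_self _ p]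
    refine integral_congr_ae (Filter.Eventually.of_forall fun x => ?_)
    simp only [indicator, mem_ball, dist_eq_norm, add_sub_cancel_left, sub_zero]
  rw [h1, integral_eq_integral_Ioi_toSphere]
  · rw [intervalIntegral.integral_of_le hr, integral_Ioc_eq_integral_Ioo,
      ← integral_indicator measurableSet_Ioi, ← integral_indicator measurableSet_Ioo]
    refine integral_congr_ae (Filter.Eventually.of_forall fun t => ?_)
    by_cases ht : 0 < t
    · have hω : ∀ ω : sphere (0 : E) 1, ‖t • (ω : E)‖ = t := fun ω => by
        rw [norm_smul, norm_eq_of_mem_sphere, mul_one, Real.norm_of_nonneg ht.le]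
      by_cases htr : t < r <;>
        simp [indicator, ht, htr, surfInt, hω]
    · simp [indicator, ht]
  · rw [integrable_indicator_iff measurableSet_ball]
    exact integrableOn_ball_of_continuous μ (by fun_prop) 0 r

theorem hasDerivAt_setIntegral_ball {f : E → ℝ} (hf : Continuous f) (p : E) {r : ℝ} (hr : 0 < r) :
    HasDerivAt (fun t => ∫ x in ball p t, f x ∂μ) (surfInt μ f p r) r := by
  have h := intervalIntegral.integral_hasDerivAt_right
    ((continuous_surfInt μ hf p).intervalIntegrable 0 r)
    ((continuous_surfInt μ hf p).stronglyMeasurableAtFilter _ _)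
    (continuous_surfInt μ hf p).continuousAt
  refine h.congr_of_eventuallyEq ?_
  filter_upwards [lt_mem_nhds hr] with t ht
  exact setIntegral_ball_eq μ hf p ht.le

theorem surfInt_add {f g : E → ℝ} (hf : Continuous f) (hg : Continuous g) (p : E) (r : ℝ) :
    surfInt μ (fun x => f x + g x) p r = surfInt μ f p r + surfInt μ g p r := by
  simp only [surfInt]
  rw [integral_add (integrable_sphere μ hf p r) (integrable_sphere μ hg p r), mul_add]

theorem surfInt_sub {f g : E → ℝ} (hf : Continuous f) (hg : Continuous g) (p : E) (r : ℝ) :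
    surfInt μ (fun x => f x - g x) p r = surfInt μ f p r - surfInt μ g p r := by
  simp only [surfInt]
  rw [integral_sub (integrable_sphere μ hf p r) (integrable_sphere μ hg p r), mul_sub]

theorem surfInt_const_mul (c : ℝ) (f : E → ℝ) (p : E) (r : ℝ) :
    surfInt μ (fun x => c * f x) p r = c * surfInt μ f p r := by
  simp only [surfInt]
  rw [integral_const_mul]; ring

theorem surfInt_sum {ι : Type*} (s : Finset ι) {f : ι → E → ℝ} (hf : ∀ i, Continuous (f i))
    (p : E) (r : ℝ) :
    surfInt μ (fun x => ∑ i ∈ s, f i x) p r = ∑ i ∈ s, surfInt μ (f i) p r := by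
  simp only [surfInt]
  rw [integral_finsetSum _ fun i _ => integrable_sphere μ (hf i) p r, Finset.mul_sum]

theorem surfInt_mono {f g : E → ℝ} (hf : Continuous f) (hg : Continuous g) (p : E) {r : ℝ}
    (hr : 0 ≤ r) (h : ∀ x, f x ≤ g x) : surfInt μ f p r ≤ surfInt μ g p r := by
  exact mul_le_mul_of_nonneg_left
    (integral_mono (integrable_sphere μ hf p r) (integrable_sphere μ hg p r) fun ω => h _)
    (pow_nonneg hr _)

theorem surfInt_nonneg {f : E → ℝ} (h : ∀ x, 0 ≤ f x) (p : E) {r : ℝ} (hr : 0 ≤ r) :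
    0 ≤ surfInt μ f p r :=
  mul_nonneg (pow_nonneg hr _) (integral_nonneg fun _ => h _)

theorem surfInt_congr {f g : E → ℝ} {p : E} {r : ℝ} (hr : 0 ≤ r)
    (h : ∀ x, ‖x - p‖ = r → f x = g x) : surfInt μ f p r = surfInt μ g p r := by
  simp only [surfInt]
  congr 2
  ext ω
  refine h _ ?_
  rw [add_sub_cancel_left, norm_smul, norm_eq_of_mem_sphere, mul_one, Real.norm_of_nonneg hr]

/-- Multiplication by a radial factor. -/
theorem surfInt_norm_mul (c : ℝ → ℝ) (f : E → ℝ) (p : E) {r : ℝ} (hr : 0 ≤ r) :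
    surfInt μ (fun x => c ‖x - p‖ * f x) p r = c r * surfInt μ f p r := by
  rw [← surfInt_const_mul]
  exact surfInt_congr μ hr fun x hx => by rw [hx]

open scoped RealInnerProductSpace

/-- Squaring removes the kink of the positive part, so the truncated weight `(r² - |x - p|²)₊²` is
differentiable across the sphere. -/
theorem hasDerivAt_max_zero_sq (s : ℝ) : HasDerivAt (fun s : ℝ => max s 0 ^ 2) (2 * max s 0) s := by
  rcases lt_trichotomy s 0 with h | rfl | h
  · rw [max_eq_right h.le, mul_zero]
    refine (hasDerivAt_const s (0 : ℝ)).congr_of_eventuallyEq ?_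
    filter_upwards [gt_mem_nhds h] with t ht
    simp [max_eq_right ht.le]
  · rw [hasDerivAt_iff_isLittleO_nhds_zero]
    simp only [zero_add, max_self, mul_zero, smul_zero, sub_zero, ne_eq, OfNat.ofNat_ne_zero,
      not_false_eq_true, zero_pow]
    have : (fun t : ℝ => t ^ 2) =o[nhds 0] fun t => t := by
      simpa using (Asymptotics.isLittleO_pow_id (𝕜 := ℝ) one_lt_two)
    refine Asymptotics.IsBigO.trans_isLittleO (Asymptotics.isBigO_of_le _ fun t => ?_) this
    rw [norm_pow, norm_pow]
    gcongr
    rw [Real.norm_eq_abs, Real.norm_eq_abs, abs_of_nonneg (le_max_right _ _)]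
    exact max_le (le_abs_self t) (abs_nonneg t)
  · rw [max_eq_left h.le]
    refine HasDerivAt.congr_of_eventuallyEq (f := fun t => t ^ 2) (by simpa using hasDerivAt_pow 2 s) ?_
    filter_upwards [lt_mem_nhds h] with t ht
    simp [max_eq_left ht.le]

/-- A divergence theorem without boundary term: integration by parts on the whole space against the
compactly supported weight `(r² - |x - p|²)₊²`. Differentiating twice in `r` will strip the weight
and produce the boundary term. -/
theorem integral_ball_weight_mul_fderiv {f : E → ℝ} (hf : ContDiff ℝ 1 f) (e p : E) {r : ℝ}
    (hr : 0 < r) :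
    ∫ x in ball p r, (r ^ 2 - ‖x - p‖ ^ 2) ^ 2 * fderiv ℝ f x e ∂μ =
      ∫ x in ball p r, 4 * (r ^ 2 - ‖x - p‖ ^ 2) * (⟪x - p, e⟫ * f x) ∂μ := by
  set φ : E → ℝ := fun x => max (r ^ 2 - ‖x - p‖ ^ 2) 0 ^ 2 with hφ
  have hin : ∀ x ∈ ball p r, 0 ≤ r ^ 2 - ‖x - p‖ ^ 2 := fun x hx => by
    rw [mem_ball, dist_eq_norm] at hx
    nlinarith [norm_nonneg (x - p)]
  have hout : ∀ x ∉ ball p r, r ^ 2 - ‖x - p‖ ^ 2 ≤ 0 := fun x hx => by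
    rw [mem_ball, dist_eq_norm, not_lt] at hx
    nlinarith
  have hd : ∀ x, HasFDerivAt φ
      ((2 * max (r ^ 2 - ‖x - p‖ ^ 2) 0) • (-(2 • (innerSL ℝ (x - p))) : E →L[ℝ] ℝ)) x := fun x => by
    have h1 : HasFDerivAt (fun x => ‖x - p‖ ^ 2) (2 • (innerSL ℝ (x - p))) x := by
      simpa using ((hasFDerivAt_id x).sub_const p).norm_sq
    have h2 : HasFDerivAt (fun x => r ^ 2 - ‖x - p‖ ^ 2) (-(2 • (innerSL ℝ (x - p)))) x :=
      h1.const_sub (r ^ 2)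
    exact (hasDerivAt_max_zero_sq (r ^ 2 - ‖x - p‖ ^ 2)).comp_hasFDerivAt x h2
  have hd' : ∀ x, fderiv ℝ φ x e = -(4 * max (r ^ 2 - ‖x - p‖ ^ 2) 0 * ⟪x - p, e⟫) := fun x => by
    rw [(hd x).fderiv]
    simp only [smul_apply, neg_apply, innerSL_apply_apply,
      smul_eq_mul, nsmul_eq_mul, Nat.cast_ofNat]
    ring
  have hφc : Continuous φ := by fun_prop
  have hφs : ∀ x ∉ closedBall p r, φ x = 0 := fun x hx => by
    simp [hφ, max_eq_right (hout x fun h => hx (ball_subset_closedBall h))]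
  have hφ's : ∀ x ∉ closedBall p r, fderiv ℝ φ x e = 0 := fun x hx => by
    rw [hd', max_eq_right (hout x fun h => hx (ball_subset_closedBall h))]; simp
  have hφ'c : Continuous fun x => fderiv ℝ φ x e := by
    simp_rw [hd']; fun_prop
  have hf'c : Continuous fun x => fderiv ℝ f x e := by
    have := hf.continuous_fderiv one_ne_zero
    fun_prop
  have hfc := hf.continuous
  have key := integral_mul_fderiv_eq_neg_fderiv_mul_of_integrable (𝕜 := ℝ) (μ := μ) (f := φ) (g := f) (v := e)
    ((hφ'c.mul hfc).integrable_of_hasCompactSupport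
      (HasCompactSupport.intro (isCompact_closedBall p r) fun x hx => by simp [hφ's x hx]))
    ((hφc.mul hf'c).integrable_of_hasCompactSupport
      (HasCompactSupport.intro (isCompact_closedBall p r) fun x hx => by simp [hφs x hx]))
    ((hφc.mul hfc).integrable_of_hasCompactSupport
      (HasCompactSupport.intro (isCompact_closedBall p r) fun x hx => by simp [hφs x hx]))
    (fun x _ => (hd x).differentiableAt) (fun x _ => (hf.differentiable one_ne_zero) x)
  have h1 : ∫ x in ball p r, φ x * fderiv ℝ f x e ∂μ = ∫ x, φ x * fderiv ℝ f x e ∂μ :=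
    setIntegral_eq_integral_of_forall_compl_eq_zero fun x hx => by
      simp [hφ, max_eq_right (hout x hx)]
  have h2 : ∫ x in ball p r, -(fderiv ℝ φ x e * f x) ∂μ = ∫ x, -(fderiv ℝ φ x e * f x) ∂μ :=
    setIntegral_eq_integral_of_forall_compl_eq_zero fun x hx => by
      simp [hd', max_eq_right (hout x hx)]
  rw [← integral_neg, ← h1, ← h2] at key
  calc _ = ∫ x in ball p r, φ x * fderiv ℝ f x e ∂μ :=
        setIntegral_congr_fun measurableSet_ball fun x hx => by
          simp only [hφ, max_eq_left (hin x hx)]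
    _ = _ := by
        rw [key]
        refine setIntegral_congr_fun measurableSet_ball fun x hx => ?_
        simp only [hd', max_eq_left (hin x hx)]
        ring

/-- The divergence theorem on a ball, for one partial derivative. -/
theorem mul_integral_ball_fderiv {f : E → ℝ} (hf : ContDiff ℝ 1 f) (e p : E) {r : ℝ}
    (hr : 0 < r) :
    r * ∫ x in ball p r, fderiv ℝ f x e ∂μ = surfInt μ (fun x => ⟪x - p, e⟫ * f x) p r := by
  have hf'c : Continuous fun x => fderiv ℝ f x e := by
    have := hf.continuous_fderiv one_ne_zero
    fun_prop
  have hfc := hf.continuous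
  set A : E → ℝ := fun x => fderiv ℝ f x e
  set B : E → ℝ := fun x => ⟪x - p, e⟫ * f x
  have hB : Continuous B := by fun_prop
  have hder : ∀ {F : E → ℝ}, Continuous F → ∀ (k : ℕ) {s : ℝ}, 0 < s →
      HasDerivAt (fun t => ∫ x in ball p t, ‖x - p‖ ^ k * F x ∂μ) (s ^ k * surfInt μ F p s) s := by
    intro F hF k s hs
    have h := hasDerivAt_setIntegral_ball μ (f := fun x => ‖x - p‖ ^ k * F x) (by fun_prop) p hs
    rwa [surfInt_norm_mul μ (fun y => y ^ k) F p hs.le] at h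
  have hint : ∀ {F : E → ℝ}, Continuous F → ∀ s, IntegrableOn F (ball p s) μ :=
    fun hF s => integrableOn_ball_of_continuous μ hF p s
  -- The weighted identity, expanded so that `s` appears only in coefficients and in the domain of
  -- integration.
  have e1 : ∀ s, 0 < s →
      s ^ 4 * ∫ x in ball p s, ‖x - p‖ ^ 0 * A x ∂μ =
      2 * s ^ 2 * ∫ x in ball p s, ‖x - p‖ ^ 2 * A x ∂μ - ∫ x in ball p s, ‖x - p‖ ^ 4 * A x ∂μ
        + (4 * s ^ 2 * ∫ x in ball p s, ‖x - p‖ ^ 0 * B x ∂μ - 4 * ∫ x in ball p s, ‖x - p‖ ^ 2 * B x ∂μ) := by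
    intro s hs
    have h := integral_ball_weight_mul_fderiv μ hf e p hs
    have h1 : ∀ x, (s ^ 2 - ‖x - p‖ ^ 2) ^ 2 * fderiv ℝ f x e =
        s ^ 4 * (‖x - p‖ ^ 0 * A x) - 2 * s ^ 2 * (‖x - p‖ ^ 2 * A x) + ‖x - p‖ ^ 4 * A x :=
      fun x => by simp only [A]; ring
    have h2 : ∀ x, 4 * (s ^ 2 - ‖x - p‖ ^ 2) * (⟪x - p, e⟫ * f x) =
        4 * s ^ 2 * (‖x - p‖ ^ 0 * B x) - 4 * (‖x - p‖ ^ 2 * B x) :=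
      fun x => by simp only [B]; ring
    simp_rw [h1, h2] at h
    rw [integral_add, integral_sub, integral_sub, integral_const_mul, integral_const_mul,
      integral_const_mul, integral_const_mul] at h
    · linarith
    all_goals exact hint (by fun_prop) s
  -- First derivative in `s`: all surface integrals cancel, because the weight vanishes to second
  -- order on the sphere. Division by `4s` leaves the identity for the weight `s² - |x - p|²`.
  have e2 : ∀ s, 0 < s →
      s ^ 2 * ∫ x in ball p s, ‖x - p‖ ^ 0 * A x ∂μ =
      ∫ x in ball p s, ‖x - p‖ ^ 2 * A x ∂μ + 2 * ∫ x in ball p s, ‖x - p‖ ^ 0 * B x ∂μ := by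
    intro s hs
    have hl := (hasDerivAt_pow 4 s).mul (hder hf'c 0 hs)
    have hrr := ((((hasDerivAt_pow 2 s).const_mul 2).mul (hder hf'c 2 hs)).sub (hder hf'c 4 hs)).add
      ((((hasDerivAt_pow 2 s).const_mul 4).mul (hder hB 0 hs)).sub ((hder hB 2 hs).const_mul 4))
    have hu := hl.unique (hrr.congr_of_eventuallyEq
      (by filter_upwards [lt_mem_nhds hs] with t ht; exact e1 t ht))
    push_cast at hu
    have : 4 * s * (s ^ 2 * ∫ x in ball p s, ‖x - p‖ ^ 0 * A x ∂μ) =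
      4 * s * (∫ x in ball p s, ‖x - p‖ ^ 2 * A x ∂μ + 2 * ∫ x in ball p s, ‖x - p‖ ^ 0 * B x ∂μ) := by
      linear_combination hu
    exact mul_left_cancel₀ (by positivity) this
  -- Second derivative: the surface integrals of `A` cancel, while that of `B` survives as the
  -- boundary term.
  have hl := (hasDerivAt_pow 2 r).mul (hder hf'c 0 hr)
  have hrr := (hder hf'c 2 hr).add ((hder hB 0 hr).const_mul 2)
  have hu := hl.unique (hrr.congr_of_eventuallyEq
      (by filter_upwards [lt_mem_nhds hr] with t ht; exact e2 t ht))
  push_cast at hu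
  simp only [pow_zero, one_mul] at hu
  linear_combination hu / 2

/-- The divergence of a vector field. -/
noncomputable def divergence (X : E → E) (x : E) : ℝ :=
  ∑ i, ⟪stdOrthonormalBasis ℝ E i, fderiv ℝ X x (stdOrthonormalBasis ℝ E i)⟫

/-- The divergence theorem on a ball. -/
theorem mul_integral_ball_divergence {X : E → E} (hX : ContDiff ℝ 1 X) (p : E) {r : ℝ}
    (hr : 0 < r) :
    r * ∫ x in ball p r, divergence X x ∂μ = surfInt μ (fun x => ⟪x - p, X x⟫) p r := by
  set b := stdOrthonormalBasis ℝ E with hb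
  have hXc := hX.continuous
  have hX' := hX.continuous_fderiv one_ne_zero
  have h1 : ∀ i x, ⟪b i, fderiv ℝ X x (b i)⟫ = fderiv ℝ (fun y => ⟪b i, X y⟫) x (b i) := by
    intro i x
    rw [fderiv_inner_apply ℝ (by fun_prop) ((hX.differentiable one_ne_zero) x)]
    simp
  have h2 : ∀ x, ⟪x - p, X x⟫ = ∑ i, ⟪x - p, b i⟫ * ⟪b i, X x⟫ := fun x =>
    (b.sum_inner_mul_inner _ _).symm
  have h3 : ∀ i, ContDiff ℝ 1 fun y => ⟪b i, X y⟫ := fun i => contDiff_const.inner ℝ hX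
  simp_rw [h2]
  rw [surfInt_sum μ _ fun i => by fun_prop]
  simp only [divergence]
  rw [integral_finsetSum _ fun i _ => integrableOn_ball_of_continuous μ (by fun_prop) p r, Finset.mul_sum]
  refine Finset.sum_congr rfl fun i _ => ?_
  simp_rw [← hb, h1]
  exact mul_integral_ball_fderiv μ (h3 i) (b i) p hr

end BallCalculus

/-! ### Green and Rellich–Pohozaev identities, and the mean square of a harmonic function. -/

section Identities

open MeasureTheory Metric Set Module
open scoped RealInnerProductSpace

variable {E : Type*} [NormedAddCommGroup E] [InnerProductSpace ℝ E] [FiniteDimensional ℝ E]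

theorem ContDiff.gradient {g : E → ℝ} (hg : ContDiff ℝ 2 g) : ContDiff ℝ 1 (∇ g) :=
  (InnerProductSpace.toDual ℝ E).symm.contDiff.comp (hg.fderiv_right le_rfl)

theorem inner_fderiv_gradient {g : E → ℝ} (hg : ContDiff ℝ 2 g) (x v w : E) :
    ⟪fderiv ℝ (∇ g) x v, w⟫ = fderiv ℝ (fderiv ℝ g) x v w := by
  have h1 : DifferentiableAt ℝ (fderiv ℝ g) x :=
    ((hg.fderiv_right (m := 1) le_rfl).differentiable one_ne_zero) x
  have h2 : (fun y => ⟪∇ g y, w⟫) = fun y => fderiv ℝ g y w := funext fun y => inner_gradient_left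
  have h3 := fderiv_inner_apply ℝ ((hg.gradient.differentiable one_ne_zero) x)
    (differentiableAt_const w) v
  rw [h2, fderiv_clm_apply h1 (differentiableAt_const w)] at h3
  simpa using h3.symm

theorem inner_fderiv_gradient_comm {g : E → ℝ} (hg : ContDiff ℝ 2 g) (x v w : E) :
    ⟪fderiv ℝ (∇ g) x v, w⟫ = ⟪fderiv ℝ (∇ g) x w, v⟫ := by
  rw [inner_fderiv_gradient hg, inner_fderiv_gradient hg]
  exact (hg.contDiffAt.isSymmSndFDerivAt (by simp)) v w

theorem laplacian_eq_sum {ι : Type*} [Fintype ι] (b : OrthonormalBasis ι ℝ E) (g : E → ℝ) (x : E) :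
    (Δ g) x = ∑ i, fderiv ℝ (fderiv ℝ g) x (b i) (b i) := by
  rw [InnerProductSpace.laplacian_eq_iteratedFDeriv_orthonormalBasis g b]
  simp [iteratedFDeriv_two_apply]

theorem continuous_laplacian {g : E → ℝ} (hg : ContDiff ℝ 2 g) : Continuous (Δ g) := by
  have h1 : Continuous (fderiv ℝ (fderiv ℝ g)) :=
    (hg.fderiv_right (m := 1) le_rfl).continuous_fderiv one_ne_zero
  have : Δ g = fun x => ∑ i, fderiv ℝ (fderiv ℝ g) x (stdOrthonormalBasis ℝ E i) (stdOrthonormalBasis ℝ E i) :=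
    funext fun x => laplacian_eq_sum _ g x
  rw [this]
  fun_prop

theorem divergence_gradient {g : E → ℝ} (hg : ContDiff ℝ 2 g) (x : E) :
    divergence (∇ g) x = (Δ g) x := by
  rw [laplacian_eq_sum (stdOrthonormalBasis ℝ E)]
  refine Finset.sum_congr rfl fun i _ => ?_
  rw [real_inner_comm, inner_fderiv_gradient hg]

theorem divergence_smul {φ : E → ℝ} {X : E → E} {x : E} (hφ : DifferentiableAt ℝ φ x)
    (hX : DifferentiableAt ℝ X x) :
    divergence (fun y => φ y • X y) x = ⟪∇ φ x, X x⟫ + φ x * divergence X x := by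
  set b := stdOrthonormalBasis ℝ E with hb
  rw [← b.sum_inner_mul_inner (∇ φ x) (X x)]
  simp only [divergence, Finset.mul_sum, ← Finset.sum_add_distrib, ← hb]
  refine Finset.sum_congr rfl fun i _ => ?_
  rw [fderiv_fun_smul hφ hX, inner_gradient_left]
  simp [inner_add_right, inner_smul_right]
  ring

theorem divergence_sub {X Y : E → E} {x : E} (hX : DifferentiableAt ℝ X x)
    (hY : DifferentiableAt ℝ Y x) :
    divergence (fun y => X y - Y y) x = divergence X x - divergence Y x := by
  simp only [divergence, ← Finset.sum_sub_distrib]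
  refine Finset.sum_congr rfl fun i _ => ?_
  rw [fderiv_fun_sub hX hY]
  simp [inner_sub_right]

theorem fderiv_id_sub_const (p x : E) : fderiv ℝ (fun y : E => y - p) x = ContinuousLinearMap.id ℝ E :=
  ((hasFDerivAt_id x).sub_const p).fderiv

theorem divergence_sub_const (p x : E) : divergence (fun y => y - p) x = finrank ℝ E := by
  simp [divergence, fderiv_id_sub_const]

theorem gradient_mul {f g : E → ℝ} {x : E} (hf : DifferentiableAt ℝ f x) (hg : DifferentiableAt ℝ g x) :
    ∇ (fun y => f y * g y) x = f x • ∇ g x + g x • ∇ f x := by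
  refine ext_inner_right ℝ fun v => ?_
  rw [inner_gradient_left, fderiv_fun_mul hf hg, inner_add_left, inner_smul_left, inner_smul_left,
    inner_gradient_left, inner_gradient_left]
  simp

theorem gradient_inner {X Y : E → E} {x : E} (hX : DifferentiableAt ℝ X x)
    (hY : DifferentiableAt ℝ Y x) (v : E) :
    ⟪∇ (fun y => ⟪X y, Y y⟫) x, v⟫ = ⟪X x, fderiv ℝ Y x v⟫ + ⟪fderiv ℝ X x v, Y x⟫ := by
  rw [inner_gradient_left, fderiv_inner_apply ℝ hX hY]

/-- Divergence of the field in the Rellich–Pohozaev identity. -/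
theorem divergence_rellich {g : E → ℝ} (hg : ContDiff ℝ 2 g) (p x : E) :
    divergence (fun y => ⟪∇ g y, ∇ g y⟫ • (y - p) - (2 * ⟪y - p, ∇ g y⟫) • ∇ g y) x =
      (finrank ℝ E - 2) * ‖∇ g x‖ ^ 2 - 2 * ⟪x - p, ∇ g x⟫ * (Δ g) x := by
  have hG : Differentiable ℝ (∇ g) := hg.gradient.differentiable one_ne_zero
  have h1 : DifferentiableAt ℝ (fun y => ⟪∇ g y, ∇ g y⟫) x := (hG x).inner ℝ (hG x)
  have h2 : DifferentiableAt ℝ (fun y : E => y - p) x := by fun_prop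
  have h3 : DifferentiableAt ℝ (fun y => ⟪y - p, ∇ g y⟫) x := h2.inner ℝ (hG x)
  have h4 : ∇ (fun y => 2 * ⟪y - p, ∇ g y⟫) x = (2 : ℝ) • ∇ (fun y => ⟪y - p, ∇ g y⟫) x := by
    refine ext_inner_right ℝ fun v => ?_
    rw [inner_gradient_left, inner_smul_left, inner_gradient_left, fderiv_const_mul h3]
    simp
  rw [divergence_sub (X := fun y => ⟪∇ g y, ∇ g y⟫ • (y - p)) (h1.smul h2)
      (Y := fun y => (2 * ⟪y - p, ∇ g y⟫) • ∇ g y) ((h3.const_mul 2).smul (hG x)), divergence_smul h1 h2,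
    divergence_smul (h3.const_mul 2) (hG x), divergence_sub_const, divergence_gradient hg, h4,
    inner_smul_left, gradient_inner (hG x) (hG x), gradient_inner h2 (hG x)]
  simp only [fderiv_id_sub_const, ContinuousLinearMap.id_apply, real_inner_self_eq_norm_sq]
  -- The two second derivative terms, `D²g(x - p, ∇g)` and `D²g(∇g, x - p)`, cancel by symmetry of
  -- the Hessian.
  rw [real_inner_comm (fderiv ℝ (∇ g) x (x - p)) (∇ g x), real_inner_comm (fderiv ℝ (∇ g) x (∇ g x)) (x - p),
    inner_fderiv_gradient_comm hg x (∇ g x) (x - p)]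
  simp
  ring

variable [MeasurableSpace E] [BorelSpace E] [Nontrivial E] (μ : Measure E) [μ.IsAddHaarMeasure]

/-- Divergence theorem for the field `f(y)(y - p)`. As a solid integral, the surface integral can be
differentiated in `r` without differentiating under the integral over the sphere. -/
theorem mul_surfInt_eq {f : E → ℝ} (hf : ContDiff ℝ 1 f) (p : E) {r : ℝ} (hr : 0 < r) :
    r * surfInt μ f p r = ∫ x in ball p r, (finrank ℝ E * f x + ⟪x - p, ∇ f x⟫) ∂μ := by
  have h := mul_integral_ball_divergence μ (X := fun y => f y • (y - p)) (by fun_prop) p hr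
  have h2 : surfInt μ (fun x => ⟪x - p, f x • (x - p)⟫) p r = r ^ 2 * surfInt μ f p r := by
    rw [← surfInt_norm_mul μ (fun t => t ^ 2) f p hr.le]
    refine surfInt_congr μ hr.le fun x _ => ?_
    rw [inner_smul_right, real_inner_self_eq_norm_sq]; ring
  have h3 : ∀ x, divergence (fun y => f y • (y - p)) x = finrank ℝ E * f x + ⟪x - p, ∇ f x⟫ := fun x => by
    rw [divergence_smul ((hf.differentiable one_ne_zero) x) (by fun_prop), divergence_sub_const, real_inner_comm]
    ring
  simp_rw [h3] at h
  rw [h2] at h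
  have : r * (∫ x in ball p r, (finrank ℝ E * f x + ⟪x - p, ∇ f x⟫) ∂μ) = r * (r * surfInt μ f p r) := by
    rw [h]; ring
  exact (mul_left_cancel₀ hr.ne' this).symm

theorem continuous_gradient {f : E → ℝ} (hf : ContDiff ℝ 1 f) : Continuous (∇ f) :=
  (InnerProductSpace.toDual ℝ E).symm.continuous.comp (hf.continuous_fderiv one_ne_zero)

theorem hasDerivAt_surfInt {f : E → ℝ} (hf : ContDiff ℝ 1 f) (p : E) {r : ℝ} (hr : 0 < r) :
    HasDerivAt (surfInt μ f p)
      ((finrank ℝ E - 1) / r * surfInt μ f p r + r⁻¹ * surfInt μ (fun x => ⟪x - p, ∇ f x⟫) p r) r := by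
  have hG := continuous_gradient hf
  have hfc := hf.continuous
  have h1 : HasDerivAt (fun t => ∫ x in ball p t, (finrank ℝ E * f x + ⟪x - p, ∇ f x⟫) ∂μ)
      (finrank ℝ E * surfInt μ f p r + surfInt μ (fun x => ⟪x - p, ∇ f x⟫) p r) r := by
    rw [← surfInt_const_mul, ← surfInt_add μ (by fun_prop) (by fun_prop)]
    exact hasDerivAt_setIntegral_ball μ (by fun_prop) p hr
  have h2 := (hasDerivAt_inv hr.ne').mul h1
  have h3 : surfInt μ f p =ᶠ[nhds r] ((·⁻¹) * fun t => ∫ x in ball p t, (finrank ℝ E * f x + ⟪x - p, ∇ f x⟫) ∂μ) := by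
    filter_upwards [lt_mem_nhds hr] with t ht
    simp only [Pi.mul_apply]
    rw [← mul_surfInt_eq μ hf p ht, inv_mul_cancel_left₀ ht.ne']
  refine (h2.congr_of_eventuallyEq h3).congr_deriv ?_
  rw [← mul_surfInt_eq μ hf p hr]
  field_simp
  ring

theorem green_ball {g : E → ℝ} (hg : ContDiff ℝ 2 g) (p : E) {r : ℝ} (hr : 0 < r) :
    r * ∫ x in ball p r, (‖∇ g x‖ ^ 2 + g x * (Δ g) x) ∂μ =
      surfInt μ (fun x => g x * ⟪x - p, ∇ g x⟫) p r := by
  have hG := hg.gradient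
  have hg1 : ContDiff ℝ 1 g := hg.of_le one_le_two
  have h := mul_integral_ball_divergence μ (X := fun y => g y • ∇ g y) (hg1.smul hG) p hr
  simp_rw [divergence_smul ((hg1.differentiable one_ne_zero) _) ((hG.differentiable one_ne_zero) _),
    divergence_gradient hg, real_inner_self_eq_norm_sq, inner_smul_right] at h
  exact h

theorem rellich_ball {g : E → ℝ} (hg : ContDiff ℝ 2 g) (p : E) {r : ℝ} (hr : 0 < r) :
    r * ∫ x in ball p r, ((finrank ℝ E - 2) * ‖∇ g x‖ ^ 2 - 2 * ⟪x - p, ∇ g x⟫ * (Δ g) x) ∂μ =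
      r ^ 2 * surfInt μ (fun x => ‖∇ g x‖ ^ 2) p r - 2 * surfInt μ (fun x => ⟪x - p, ∇ g x⟫ ^ 2) p r := by
  have hG := hg.gradient
  have hGc := hG.continuous
  have h1 : ContDiff ℝ 1 (fun y : E => y - p) := by fun_prop
  have h2 : ContDiff ℝ 1 fun y => ⟪∇ g y, ∇ g y⟫ • (y - p) - (2 * ⟪y - p, ∇ g y⟫) • ∇ g y :=
    ((hG.inner ℝ hG).smul h1).sub ((contDiff_const.mul (h1.inner ℝ hG)).smul hG)
  have h := mul_integral_ball_divergence μ h2 p hr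
  simp_rw [divergence_rellich hg] at h
  rw [h, ← surfInt_norm_mul μ (fun t => t ^ 2) _ p hr.le, ← surfInt_const_mul, ← surfInt_sub μ (by fun_prop) (by fun_prop)]
  refine surfInt_congr μ hr.le fun x _ => ?_
  rw [inner_sub_right, inner_smul_right, inner_smul_right, real_inner_self_eq_norm_sq,
    real_inner_self_eq_norm_sq]
  ring

/-- The field `(r² - |x - p|²) h∇h` vanishes on the sphere, so its divergence integrates to zero.
For harmonic `h` this says that twice the integral equals `∫ (r² - |x - p|²)|∇h|²`. -/
theorem integral_inner_gradient_sq_nonneg {h : E → ℝ} (hh : ContDiff ℝ 2 h) (p : E) {r : ℝ} (hr : 0 < r)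
    (hΔ : ∀ x ∈ ball p r, (Δ h) x = 0) : 0 ≤ ∫ x in ball p r, h x * ⟪x - p, ∇ h x⟫ ∂μ := by
  have hG := hh.gradient
  have hGc := hG.continuous
  have hhc := hh.continuous
  have hh1 : ContDiff ℝ 1 h := hh.of_le one_le_two
  have hX : ContDiff ℝ 1 fun y => h y • ∇ h y := hh1.smul hG
  have hw : ContDiff ℝ 1 fun y : E => r ^ 2 - ⟪y - p, y - p⟫ := by
    have h1 : ContDiff ℝ 1 (fun y : E => y - p) := by fun_prop
    exact contDiff_const.sub (h1.inner ℝ h1)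
  have key := mul_integral_ball_divergence μ (X := fun y => (r ^ 2 - ⟪y - p, y - p⟫) • h y • ∇ h y)
    (hw.smul hX) p hr
  have hs : surfInt μ (fun x => ⟪x - p, (r ^ 2 - ⟪x - p, x - p⟫) • h x • ∇ h x⟫) p r = 0 := by
    have : surfInt μ (fun x => ⟪x - p, (r ^ 2 - ⟪x - p, x - p⟫) • h x • ∇ h x⟫) p r =
        surfInt μ (fun _ => 0 * 0) p r := surfInt_congr μ hr.le fun x hx => by
      rw [inner_smul_right, real_inner_self_eq_norm_sq, hx]; ring
    rw [this, surfInt_const_mul, zero_mul]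
  have hgr : ∀ x v, ⟪∇ (fun y : E => r ^ 2 - ⟪y - p, y - p⟫) x, v⟫ = -(2 * ⟪x - p, v⟫) := fun x v => by
    have h1 : DifferentiableAt ℝ (fun y : E => y - p) x := by fun_prop
    have h2 := gradient_inner h1 h1 v
    rw [inner_gradient_left] at h2 ⊢
    rw [fderiv_const_sub]
    simp only [neg_apply, h2]
    rw [fderiv_id_sub_const, ContinuousLinearMap.id_apply, real_inner_comm v]
    ring
  simp_rw [divergence_smul ((hw.differentiable one_ne_zero) _) ((hX.differentiable one_ne_zero) _),
    divergence_smul ((hh1.differentiable one_ne_zero) _) ((hG.differentiable one_ne_zero) _), hgr,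
    divergence_gradient hh, inner_smul_right] at key
  rw [show surfInt μ _ p r = 0 by simpa only [inner_smul_right] using hs] at key
  have key2 := (mul_eq_zero.1 key).resolve_left hr.ne'
  have h3 : ∫ x in ball p r, 2 * (h x * ⟪x - p, ∇ h x⟫) ∂μ =
      ∫ x in ball p r, (r ^ 2 - ‖x - p‖ ^ 2) * ‖∇ h x‖ ^ 2 ∂μ := by
    rw [← sub_eq_zero, ← integral_sub (integrableOn_ball_of_continuous μ (by fun_prop) p r)
      (integrableOn_ball_of_continuous μ (by fun_prop) p r), ← neg_eq_zero, ← integral_neg, ← key2]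
    refine setIntegral_congr_fun measurableSet_ball fun x hx => ?_
    simp only [hΔ x hx, real_inner_self_eq_norm_sq]
    ring
  rw [integral_const_mul] at h3
  have h4 : 0 ≤ ∫ x in ball p r, (r ^ 2 - ‖x - p‖ ^ 2) * ‖∇ h x‖ ^ 2 ∂μ := by
    refine setIntegral_nonneg measurableSet_ball fun x hx => ?_
    rw [mem_ball, dist_eq_norm] at hx
    have : 0 ≤ r ^ 2 - ‖x - p‖ ^ 2 := by nlinarith [norm_nonneg (x - p)]
    positivity
  linarith

/-- The `L²` norm of a harmonic function on a ball is controlled by that on its boundary. -/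
theorem finrank_mul_integral_ball_sq_le {h : E → ℝ} (hh : ContDiff ℝ 2 h) (p : E) {r : ℝ} (hr : 0 < r)
    (hΔ : ∀ x ∈ ball p r, (Δ h) x = 0) :
    finrank ℝ E * ∫ x in ball p r, h x ^ 2 ∂μ ≤ r * surfInt μ (fun x => h x ^ 2) p r := by
  have hGc := hh.gradient.continuous
  have hhc := hh.continuous
  have hh1 : ContDiff ℝ 1 h := hh.of_le one_le_two
  have hsq : ContDiff ℝ 1 fun x => h x ^ 2 := hh1.pow 2
  rw [mul_surfInt_eq μ hsq p hr, ← integral_const_mul]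
  have h1 : ∀ x, ⟪x - p, ∇ (fun x => h x ^ 2) x⟫ = 2 * (h x * ⟪x - p, ∇ h x⟫) := fun x => by
    have hd := (hh1.differentiable one_ne_zero) x
    simp_rw [pow_two]
    rw [gradient_mul hd hd, inner_add_right, inner_smul_right]
    ring
  simp_rw [h1]
  rw [integral_add (integrableOn_ball_of_continuous μ (by fun_prop) p r)
      (integrableOn_ball_of_continuous μ (by fun_prop) p r), integral_const_mul 2]
  linarith [integral_inner_gradient_sq_nonneg μ hh p hr hΔ]

end Identities

/-! ### Energy and sphere mass of the coupled system, with their derivatives. -/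

section FrequencyIdentities

open MeasureTheory Metric Set Module
open scoped RealInnerProductSpace

variable {E : Type*} [NormedAddCommGroup E] [InnerProductSpace ℝ E] [FiniteDimensional ℝ E]
  [MeasurableSpace E] [BorelSpace E] [Nontrivial E] (μ : Measure E) [μ.IsAddHaarMeasure]

/-- The energy density `|∇g|² + |∇h|² + g h + 2 lam g²`. -/
noncomputable def energyDensity (lam : ℝ) (g h : E → ℝ) (x : E) : ℝ :=
  ‖∇ g x‖ ^ 2 + ‖∇ h x‖ ^ 2 + g x * h x + 2 * lam * g x ^ 2

/-- The energy of the pair `(g, h)` on a ball. -/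
noncomputable def ballEnergy (lam : ℝ) (g h : E → ℝ) (p : E) (r : ℝ) : ℝ :=
  ∫ x in ball p r, energyDensity lam g h x ∂μ

/-- The integral of `g² + h²` on a sphere. -/
noncomputable def sphereMass (g h : E → ℝ) (p : E) (r : ℝ) : ℝ :=
  surfInt μ (fun x => g x ^ 2 + h x ^ 2) p r

/-- `Δg = h + 2 lam g` and `Δh = 0` on the set `s`. -/
structure CoupledSystem (lam : ℝ) (g h : E → ℝ) (s : Set E) : Prop where
  contDiff_left : ContDiff ℝ 2 g
  contDiff_right : ContDiff ℝ 2 h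
  laplacian_left : ∀ x ∈ s, (Δ g) x = h x + 2 * lam * g x
  laplacian_right : ∀ x ∈ s, (Δ h) x = 0

namespace CoupledSystem

variable {lam : ℝ} {g h : E → ℝ} {p : E} {r : ℝ}

theorem mono {s t : Set E} (S : CoupledSystem lam g h t) (hst : s ⊆ t) : CoupledSystem lam g h s :=
  ⟨S.1, S.2, fun x hx => S.3 x (hst hx), fun x hx => S.4 x (hst hx)⟩

/-- By the system, the energy density is `|∇g|² + gΔg + |∇h|² + hΔh`; Green's formula applies to
each half. -/
theorem mul_ballEnergy (S : CoupledSystem lam g h (ball p r)) (hr : 0 < r) :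
    r * ballEnergy μ lam g h p r =
      surfInt μ (fun x => g x * ⟪x - p, ∇ g x⟫ + h x * ⟪x - p, ∇ h x⟫) p r := by
  have hgc := S.1.continuous
  have hhc := S.2.continuous
  have hGc := S.1.gradient.continuous
  have hHc := S.2.gradient.continuous
  have hLg := continuous_laplacian S.1
  have hLh := continuous_laplacian S.2
  rw [surfInt_add μ (by fun_prop) (by fun_prop), ← green_ball μ S.1 p hr, ← green_ball μ S.2 p hr,
    ← mul_add, ← integral_add (integrableOn_ball_of_continuous μ (by fun_prop) p r)
      (integrableOn_ball_of_continuous μ (by fun_prop) p r)]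
  congr 1
  refine setIntegral_congr_fun measurableSet_ball fun x hx => ?_
  simp only [energyDensity, S.3 x hx, S.4 x hx]
  ring

theorem hasDerivAt_sphereMass (S : CoupledSystem lam g h (ball p r)) (hr : 0 < r) :
    HasDerivAt (sphereMass μ g h p)
      ((finrank ℝ E - 1) / r * sphereMass μ g h p r + 2 * ballEnergy μ lam g h p r) r := by
  have hg1 : ContDiff ℝ 1 g := S.1.of_le one_le_two
  have hh1 : ContDiff ℝ 1 h := S.2.of_le one_le_two
  have hf : ContDiff ℝ 1 fun x => g x ^ 2 + h x ^ 2 := (hg1.pow 2).add (hh1.pow 2)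
  refine (hasDerivAt_surfInt μ hf p hr).congr_deriv ?_
  have h1 : ∀ x, ⟪x - p, ∇ (fun x => g x ^ 2 + h x ^ 2) x⟫ =
      2 * (g x * ⟪x - p, ∇ g x⟫ + h x * ⟪x - p, ∇ h x⟫) := fun x => by
    have hdg := (hg1.differentiable one_ne_zero) x
    have hdh := (hh1.differentiable one_ne_zero) x
    simp only [real_inner_comm _ (x - p), inner_gradient_left]
    rw [fderiv_fun_add (hdg.fun_pow 2) (hdh.fun_pow 2), fderiv_fun_pow 2 hdg, fderiv_fun_pow 2 hdh]
    simp
    ring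
  simp_rw [h1]
  rw [surfInt_const_mul, ← S.mul_ballEnergy μ hr, sphereMass]
  field_simp

theorem hasDerivAt_ballEnergy (S : CoupledSystem lam g h (ball p r)) (hr : 0 < r) :
    HasDerivAt (ballEnergy μ lam g h p) (surfInt μ (energyDensity lam g h) p r) r := by
  have hgc := S.1.continuous
  have hhc := S.2.continuous
  have hGc := S.1.gradient.continuous
  have hHc := S.2.gradient.continuous
  exact hasDerivAt_setIntegral_ball μ (by unfold energyDensity; fun_prop) p hr

theorem sphereMass_nonneg (g h : E → ℝ) (p : E) {r : ℝ} (hr : 0 ≤ r) : 0 ≤ sphereMass μ g h p r :=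
  surfInt_nonneg μ (fun x => by positivity) p hr

theorem finrank_mul_integral_sq_right_le (S : CoupledSystem lam g h (ball p r)) (hr : 0 < r) :
    finrank ℝ E * ∫ x in ball p r, h x ^ 2 ∂μ ≤ r * sphereMass μ g h p r := by
  have hgc := S.1.continuous
  have hhc := S.2.continuous
  refine (finrank_mul_integral_ball_sq_le μ S.2 p hr S.4).trans ?_
  gcongr
  exact surfInt_mono μ (by fun_prop) (by fun_prop) p hr.le fun x => by nlinarith [sq_nonneg (g x)]

/-- The indefinite term satisfies `gh ≥ -g² - h²/4`, and `2λg²` absorbs `-g²`. -/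
theorem integral_norm_gradient_sq_le (S : CoupledSystem lam g h (ball p r)) (hlam : 1 ≤ lam) :
    ∫ x in ball p r, ‖∇ g x‖ ^ 2 ∂μ ≤
      ballEnergy μ lam g h p r + 1 / 4 * ∫ x in ball p r, h x ^ 2 ∂μ := by
  have hgc := S.1.continuous
  have hhc := S.2.continuous
  have hGc := S.1.gradient.continuous
  have hHc := S.2.gradient.continuous
  rw [← integral_const_mul, ballEnergy, ← integral_add
    (integrableOn_ball_of_continuous μ (by unfold energyDensity; fun_prop) p r)
    (integrableOn_ball_of_continuous μ (by fun_prop) p r)]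
  refine setIntegral_mono (integrableOn_ball_of_continuous μ (by fun_prop) p r)
    (integrableOn_ball_of_continuous μ (by unfold energyDensity; fun_prop) p r) fun x => ?_
  simp only [energyDensity]
  nlinarith [sq_nonneg (g x + h x / 2), sq_nonneg (‖∇ h x‖), sq_nonneg (g x)]

/-- The energy may be negative through `gh`, but only by a small multiple of the sphere mass: it is
at least `-¼ ∫ h²`, and harmonicity bounds `∫ h²`. -/
theorem neg_mul_sphereMass_le (S : CoupledSystem lam g h (ball p r)) (hlam : 1 ≤ lam) (hr : 0 < r)  :
    -(r * sphereMass μ g h p r) ≤ 4 * finrank ℝ E * ballEnergy μ lam g h p r := by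
  have h1 := S.integral_norm_gradient_sq_le μ hlam
  have h2 := S.finrank_mul_integral_sq_right_le μ hr
  have h3 : 0 ≤ ∫ x in ball p r, ‖∇ g x‖ ^ 2 ∂μ := integral_nonneg fun x => by positivity
  have hm : (0 : ℝ) < finrank ℝ E := by exact_mod_cast finrank_pos
  nlinarith

/-- Cauchy–Schwarz on the sphere. -/
theorem sq_mul_ballEnergy_le (S : CoupledSystem lam g h (ball p r)) (hr : 0 < r) :
    (r * ballEnergy μ lam g h p r) ^ 2 ≤ sphereMass μ g h p r *
      surfInt μ (fun x => ⟪x - p, ∇ g x⟫ ^ 2 + ⟪x - p, ∇ h x⟫ ^ 2) p r := by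
  have hgc := S.1.continuous
  have hhc := S.2.continuous
  have hGc := S.1.gradient.continuous
  have hHc := S.2.gradient.continuous
  -- The quadratic in `s` is the integral of `|s(g, h) - (x - p)·∇(g, h)|²`; its discriminant is
  -- nonpositive.
  have key : ∀ s : ℝ, 0 ≤ sphereMass μ g h p r * (s * s) + -(2 * (r * ballEnergy μ lam g h p r)) * s +
      surfInt μ (fun x => ⟪x - p, ∇ g x⟫ ^ 2 + ⟪x - p, ∇ h x⟫ ^ 2) p r := fun s => by
    have h1 : 0 ≤ surfInt μ (fun x => (s * g x - ⟪x - p, ∇ g x⟫) ^ 2 + (s * h x - ⟪x - p, ∇ h x⟫) ^ 2) p r :=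
      surfInt_nonneg μ (fun x => by positivity) p hr.le
    have h2 : (fun x => (s * g x - ⟪x - p, ∇ g x⟫) ^ 2 + (s * h x - ⟪x - p, ∇ h x⟫) ^ 2) =
        fun x => s ^ 2 * (g x ^ 2 + h x ^ 2) -
          2 * s * (g x * ⟪x - p, ∇ g x⟫ + h x * ⟪x - p, ∇ h x⟫) +
          (⟪x - p, ∇ g x⟫ ^ 2 + ⟪x - p, ∇ h x⟫ ^ 2) := by
      ext x; ring
    rw [h2, surfInt_add μ (by fun_prop) (by fun_prop), surfInt_sub μ (by fun_prop) (by fun_prop),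
      surfInt_const_mul, surfInt_const_mul, ← S.mul_ballEnergy μ hr] at h1
    rw [sphereMass]
    linarith
  have := discrim_le_zero key
  rw [discrim] at this
  nlinarith

/-- Arithmetic of the error in the Rellich identity. Here `D` is the energy and `M` the sphere mass;
`A, B, P, Q, J` are the solid integrals of `|∇g|²`, `h²`, `gh`, `g²`, `⟨x - p, ∇g⟩h`, and `G` is the
surface integral of `gh`. The term in `P` is absorbed by `4λQ`, so the bound does not depend on `λ`.
-/
theorem lower_order_bound {m r lam D M A B P Q J G : ℝ} (hr : 0 < r) (hr1 : r ≤ 1) (hm : 2 ≤ m)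
    (hM : 0 ≤ M) (hG : -M ≤ 2 * G) (hJ : 2 * J ≤ r * (A + B))
    (hP : (m - 2) * P ≤ 4 * lam * Q + (m - 2) ^ 2 / 16 * B) (hA : A ≤ D + 1 / 4 * B)
    (hB : m * B ≤ r * M) (hB0 : 0 ≤ B) :
    -(r ^ 2 * (D + m * M)) ≤
      4 * lam * r * Q - r * (m - 2) * P - 2 * r * J + r ^ 2 * G := by
  have c2 : r * ((m - 2) ^ 2 / 16 * B) ≤ r ^ 2 * (m / 16 * M) := by
    have h1 : (m - 2) ^ 2 / 16 * B ≤ m / 16 * (m * B) := by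
      have : (m - 2) ^ 2 ≤ m ^ 2 := by nlinarith
      nlinarith
    have h2 : m / 16 * (m * B) ≤ m / 16 * (r * M) := by gcongr
    calc _ ≤ r * (m / 16 * (r * M)) := mul_le_mul_of_nonneg_left (h1.trans h2) hr.le
      _ = _ := by ring
  have c3 : B ≤ 1 / 2 * M := by nlinarith
  have c4 : r * (2 * J) ≤ r ^ 2 * (D + 5 / 8 * M) := by
    calc r * (2 * J) ≤ r * (r * (A + B)) := mul_le_mul_of_nonneg_left hJ hr.le
      _ = r ^ 2 * (A + B) := by ring
      _ ≤ _ := mul_le_mul_of_nonneg_left (by linarith) (sq_nonneg r)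
  have c5 := mul_le_mul_of_nonneg_left hP hr.le
  have c6 := mul_le_mul_of_nonneg_left hG (sq_nonneg r)
  have c7 : r ^ 2 * ((1 / 2 + 5 / 8 + m / 16) * M) ≤ r ^ 2 * (m * M) :=
    mul_le_mul_of_nonneg_left (mul_le_mul_of_nonneg_right (by linarith) hM) (sq_nonneg r)
  linarith

/-- The Rellich identity for the system, up to lower order terms. -/
theorem mul_deriv_ballEnergy_ge (S : CoupledSystem lam g h (ball p r)) (hlam : 1 ≤ lam)
    (hr : 0 < r) (hr1 : r ≤ 1) (hm : 2 ≤ finrank ℝ E) :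
    2 * surfInt μ (fun x => ⟪x - p, ∇ g x⟫ ^ 2 + ⟪x - p, ∇ h x⟫ ^ 2) p r +
      r * (finrank ℝ E - 2) * ballEnergy μ lam g h p r -
      r ^ 2 * (ballEnergy μ lam g h p r + finrank ℝ E * sphereMass μ g h p r) ≤
    r ^ 2 * surfInt μ (energyDensity lam g h) p r := by
  have hgc := S.1.continuous
  have hhc := S.2.continuous
  have hGc := S.1.gradient.continuous
  have hHc := S.2.gradient.continuous
  have hLg := continuous_laplacian S.1
  have hLh := continuous_laplacian S.2
  set m : ℝ := (finrank ℝ E : ℝ) with hmdef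
  have hm2 : (2 : ℝ) ≤ m := by rw [hmdef]; exact_mod_cast hm
  have iB : ∀ {F : E → ℝ}, Continuous F → Integrable F (μ.restrict (ball p r)) :=
    fun hF => integrableOn_ball_of_continuous μ hF p r
  set Ig := ∫ x in ball p r, ‖∇ g x‖ ^ 2 ∂μ with hIg
  set Ih := ∫ x in ball p r, ‖∇ h x‖ ^ 2 ∂μ with hIh
  set Igh := ∫ x in ball p r, g x * h x ∂μ with hIgh
  set Igg := ∫ x in ball p r, g x ^ 2 ∂μ with hIgg
  set Ihh := ∫ x in ball p r, h x ^ 2 ∂μ with hIhh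
  set J := ∫ x in ball p r, ⟪x - p, ∇ g x⟫ * h x ∂μ with hJ
  set T := ∫ x in ball p r, ⟪x - p, ∇ g x⟫ * g x ∂μ with hT
  set D := ballEnergy μ lam g h p r with hD
  set Hs := sphereMass μ g h p r with hHs
  have hDsum : D = Ig + Ih + Igh + 2 * lam * Igg := by
    rw [hD, ballEnergy]
    simp only [energyDensity]
    rw [integral_add (iB (by fun_prop)) (iB (by fun_prop)), integral_add (iB (by fun_prop)) (iB (by fun_prop)),
      integral_add (iB (by fun_prop)) (iB (by fun_prop)), integral_const_mul]
  have hDer : surfInt μ (energyDensity lam g h) p r =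
      surfInt μ (fun x => ‖∇ g x‖ ^ 2) p r + surfInt μ (fun x => ‖∇ h x‖ ^ 2) p r +
      surfInt μ (fun x => g x * h x) p r + 2 * lam * surfInt μ (fun x => g x ^ 2) p r := by
    unfold energyDensity
    rw [surfInt_add μ (by fun_prop) (by fun_prop), surfInt_add μ (by fun_prop) (by fun_prop),
      surfInt_add μ (by fun_prop) (by fun_prop), surfInt_const_mul]
  have hRg := rellich_ball μ S.1 p hr
  have hRh := rellich_ball μ S.2 p hr
  have hRg' : ∫ x in ball p r, ((m - 2) * ‖∇ g x‖ ^ 2 - 2 * ⟪x - p, ∇ g x⟫ * (Δ g) x) ∂μ =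
      (m - 2) * Ig - 2 * J - 4 * lam * T := by
    have : ∫ x in ball p r, ((m - 2) * ‖∇ g x‖ ^ 2 - 2 * ⟪x - p, ∇ g x⟫ * (Δ g) x) ∂μ =
        ∫ x in ball p r, ((m - 2) * ‖∇ g x‖ ^ 2 - 2 * (⟪x - p, ∇ g x⟫ * h x)
          - 4 * lam * (⟪x - p, ∇ g x⟫ * g x)) ∂μ :=
      setIntegral_congr_fun measurableSet_ball fun x hx => by simp only [S.3 x hx]; ring
    rw [this, integral_sub (iB (by fun_prop)) (iB (by fun_prop)),
      integral_sub (iB (by fun_prop)) (iB (by fun_prop)), integral_const_mul, integral_const_mul,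
      integral_const_mul]
  have hRh' : ∫ x in ball p r, ((m - 2) * ‖∇ h x‖ ^ 2 - 2 * ⟪x - p, ∇ h x⟫ * (Δ h) x) ∂μ =
      (m - 2) * Ih := by
    rw [← integral_const_mul]
    exact setIntegral_congr_fun measurableSet_ball fun x hx => by simp only [S.4 x hx]; ring
  rw [hRg'] at hRg
  rw [hRh'] at hRh
  have hg1 : ContDiff ℝ 1 g := S.1.of_le one_le_two
  have hsq := mul_surfInt_eq μ (hg1.pow 2) p hr
  have hsq' : ∫ x in ball p r, (m * g x ^ 2 + ⟪x - p, ∇ (fun y => g y ^ 2) x⟫) ∂μ = m * Igg + 2 * T := by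
    have h1 : ∀ x, ⟪x - p, ∇ (fun x => g x ^ 2) x⟫ = 2 * (⟪x - p, ∇ g x⟫ * g x) := fun x => by
      have hd := (hg1.differentiable one_ne_zero) x
      simp_rw [pow_two]
      rw [gradient_mul hd hd, inner_add_right, inner_smul_right]
      ring
    simp_rw [h1]
    rw [integral_add (iB (by fun_prop)) (iB (by fun_prop)), integral_const_mul, integral_const_mul]
  rw [hsq'] at hsq
  have hK := surfInt_add μ (f := fun x => ⟪x - p, ∇ g x⟫ ^ 2) (g := fun x => ⟪x - p, ∇ h x⟫ ^ 2)
    (by fun_prop) (by fun_prop) p r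
  have b1 : -Hs ≤ 2 * surfInt μ (fun x => g x * h x) p r := by
    rw [hHs, sphereMass, ← surfInt_const_mul, neg_le_iff_add_nonneg, ← surfInt_add μ (by fun_prop) (by fun_prop)]
    exact surfInt_nonneg μ (fun x => by nlinarith [sq_nonneg (g x + h x)]) p hr.le
  have b2 : 2 * J ≤ r * (Ig + Ihh) := by
    rw [hJ, hIg, hIhh, ← integral_add (iB (by fun_prop)) (iB (by fun_prop)), ← integral_const_mul,
      ← integral_const_mul]
    refine setIntegral_mono_on (iB (by fun_prop)) (iB (by fun_prop)) measurableSet_ball fun x hx => ?_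
    rw [mem_ball, dist_eq_norm] at hx
    have h1 : ⟪x - p, ∇ g x⟫ * h x ≤ ‖x - p‖ * ‖∇ g x‖ * |h x| := by
      refine (le_abs_self _).trans ?_
      rw [abs_mul]
      gcongr
      exact abs_real_inner_le_norm _ _
    have h2 : ‖x - p‖ * ‖∇ g x‖ * |h x| ≤ r * ‖∇ g x‖ * |h x| := by gcongr
    have h3 := mul_nonneg hr.le (sq_nonneg (‖∇ g x‖ - |h x|))
    rw [sub_sq, sq_abs] at h3
    linarith
  have b3 : (m - 2) * Igh ≤ 4 * lam * Igg + (m - 2) ^ 2 / 16 * Ihh := by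
    rw [hIgh, hIgg, hIhh, ← integral_const_mul, ← integral_const_mul, ← integral_const_mul,
      ← integral_add (iB (by fun_prop)) (iB (by fun_prop))]
    refine setIntegral_mono (iB (by fun_prop)) (iB (by fun_prop)) fun x => ?_
    simp only
    linarith [sq_nonneg (2 * g x - (m - 2) / 4 * h x), mul_nonneg (sub_nonneg.2 hlam) (sq_nonneg (g x))]
  have b4 := S.integral_norm_gradient_sq_le μ hlam
  have b5 := S.finrank_mul_integral_sq_right_le μ hr
  have b6 : 0 ≤ Ihh := integral_nonneg fun x => sq_nonneg _
  rw [← hIg, ← hIhh, ← hD] at b4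
  rw [← hmdef, ← hIhh, ← hHs] at b5
  have hH0 : 0 ≤ Hs := sphereMass_nonneg μ g h p hr.le
  -- The term `4λT`, large and without sign, cancels exactly against the surface integral of `2λg²`
  -- rewritten through `hsq`; what remains is the favourable `4λr ∫ g²`.
  have c1 : r ^ 2 * surfInt μ (energyDensity lam g h) p r =
      2 * surfInt μ (fun x => ⟪x - p, ∇ g x⟫ ^ 2 + ⟪x - p, ∇ h x⟫ ^ 2) p r + r * (m - 2) * D
      + (4 * lam * r * Igg - r * (m - 2) * Igh - 2 * r * J + r ^ 2 * surfInt μ (fun x => g x * h x) p r) := by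
    rw [hDer, hK, hDsum]
    linear_combination (-1 : ℝ) * hRg - hRh + 2 * lam * r * hsq
  have c2 := lower_order_bound hr hr1 hm2 hH0 b1 b2 b3 b4 b5 b6
  rw [c1]
  linarith

end CoupledSystem
end FrequencyIdentities

/-! ### Almost monotonicity, doubling and change of centre. -/

section FrequencyMonotonicity

open MeasureTheory Metric Set Module

variable {E : Type*} [NormedAddCommGroup E] [InnerProductSpace ℝ E] [FiniteDimensional ℝ E]
  [MeasurableSpace E] [BorelSpace E] [Nontrivial E] (μ : Measure E) [μ.IsAddHaarMeasure]

/-- The frequency of the pair `(g, h)` on the ball `B_r(p)`. -/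
noncomputable def frequency (lam : ℝ) (g h : E → ℝ) (p : E) (r : ℝ) : ℝ :=
  r * (ballEnergy μ lam g h p r / sphereMass μ g h p r)

namespace CoupledSystem

variable {lam : ℝ} {g h : E → ℝ} {p : E} {r s R : ℝ}

theorem continuous_sphereMass (S : CoupledSystem lam g h (ball p R)) :
    Continuous (sphereMass μ g h p) := by
  have hgc := S.1.continuous
  have hhc := S.2.continuous
  exact continuous_surfInt μ (f := fun x => g x ^ 2 + h x ^ 2) (by fun_prop) p

/-- In `H' = (m - 1)/t · H + 2D` the first term is at least `H`, since `t ≤ 1` and `m ≥ 2`, and this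
outweighs the possible negativity of `2D ≥ -H`. -/
theorem monotoneOn_sphereMass (S : CoupledSystem lam g h (ball p R)) (hlam : 1 ≤ lam)
    (hR : R ≤ 1) (hm : 2 ≤ finrank ℝ E) : MonotoneOn (sphereMass μ g h p) (Ioc 0 R) := by
  have hd : ∀ t ∈ Ioc 0 R, HasDerivAt (sphereMass μ g h p)
      ((finrank ℝ E - 1) / t * sphereMass μ g h p t + 2 * ballEnergy μ lam g h p t) t := fun t ht =>
    (S.mono (ball_subset_ball ht.2)).hasDerivAt_sphereMass μ ht.1
  refine monotoneOn_of_hasDerivWithinAt_nonneg (convex_Ioc 0 R)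
    (S.continuous_sphereMass μ).continuousOn
    (fun t ht => (hd t (interior_subset ht)).hasDerivWithinAt) fun t ht => ?_
  have ht' : t ∈ Ioc 0 R := interior_subset ht
  have h1 := (S.mono (ball_subset_ball ht'.2)).neg_mul_sphereMass_le μ hlam ht'.1
  have h2 := sphereMass_nonneg μ g h p ht'.1.le
  have hm' : (2 : ℝ) ≤ finrank ℝ E := by exact_mod_cast hm
  have ht1 : t ≤ 1 := ht'.2.trans hR
  have h3 : sphereMass μ g h p t ≤ (finrank ℝ E - 1) / t * sphereMass μ g h p t := by
    refine le_mul_of_one_le_left h2 ?_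
    rw [le_div_iff₀ ht'.1]; linarith
  have h4 : t * sphereMass μ g h p t ≤ sphereMass μ g h p t := mul_le_of_le_one_left h2 ht1
  have h5 : -(sphereMass μ g h p t) ≤ 2 * ballEnergy μ lam g h p t := by
    by_contra! hlt
    nlinarith
  linarith

theorem frequency_add_nonneg (S : CoupledSystem lam g h (ball p r)) (hlam : 1 ≤ lam)
    (hr : 0 < r) (hr1 : r ≤ 1) : 0 ≤ frequency μ lam g h p r + finrank ℝ E := by
  have h2 := sphereMass_nonneg μ g h p hr.le
  rcases h2.eq_or_lt with h0 | hpos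
  · rw [frequency, ← h0]; simp
  have h1 := S.neg_mul_sphereMass_le μ hlam hr
  have hm : (1 : ℝ) ≤ finrank ℝ E := by exact_mod_cast finrank_pos (R := ℝ) (M := E)
  have h3 : -1 ≤ ballEnergy μ lam g h p r / sphereMass μ g h p r := by
    rw [le_div_iff₀ hpos]
    have h4 : r * sphereMass μ g h p r ≤ sphereMass μ g h p r := mul_le_of_le_one_left h2 hr1
    by_contra! hlt
    nlinarith
  have : -r ≤ frequency μ lam g h p r := by
    rw [frequency]
    nlinarith
  linarith

/-- With `X = D'`, this is `N + m + N' ≥ 0`. The dimensional terms in `N'` cancel, `2K` dominates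
`2(rD)²/M`, and the error contributes at worst `-N - rm`, leaving `(1 - r)m ≥ 0`. -/
theorem frequency_deriv_bound {m r D M X K : ℝ} (hr : 0 < r) (hr1 : r ≤ 1) (hm : 0 ≤ m) (hM : 0 < M)
    (h1 : 2 * K + r * (m - 2) * D - r ^ 2 * (D + m * M) ≤ r ^ 2 * X) (h2 : (r * D) ^ 2 ≤ M * K) :
    0 ≤ r * (D / M) + m + (D / M + r * ((X * M - D * ((m - 1) / r * M + 2 * D)) / M ^ 2)) := by
  have key : r * (D / M) + m + (D / M + r * ((X * M - D * ((m - 1) / r * M + 2 * D)) / M ^ 2)) =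
      (r ^ 2 * D * M + r * m * M ^ 2 + r * D * M + r ^ 2 * X * M - r * D * (m - 1) * M
        - 2 * (r * D) ^ 2) / (r * M ^ 2) := by
    field_simp
    ring
  rw [key]
  refine div_nonneg ?_ (by positivity)
  have h3 := mul_le_mul_of_nonneg_right h1 hM.le
  have h4 : 0 ≤ (1 - r) * (r * m * M ^ 2) := mul_nonneg (by linarith) (by positivity)
  linarith

/-- Almost monotonicity of the frequency. -/
theorem frequency_add_le (S : CoupledSystem lam g h (ball p R)) (hlam : 1 ≤ lam)
    (hR : R ≤ 1) (hm : 2 ≤ finrank ℝ E) (hr : 0 < r) (hrs : r ≤ s) (hsR : s ≤ R)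
    (hpos : 0 < sphereMass μ g h p r) :
    frequency μ lam g h p r + finrank ℝ E ≤ 3 * (frequency μ lam g h p s + finrank ℝ E) := by
  have hH : ∀ t ∈ Icc r s, 0 < sphereMass μ g h p t := fun t ht => hpos.trans_le <|
    S.monotoneOn_sphereMass μ hlam hR hm ⟨hr, hrs.trans hsR⟩
      ⟨hr.trans_le ht.1, ht.2.trans hsR⟩ ht.1
  -- The integrating factor `e^t` turns `N' ≥ -(N + m)` into monotonicity; the constant 3 bounds
  -- `e^{s-r} ≤ e`.
  have hd : ∀ t ∈ Icc r s, HasDerivAt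
      (fun t => Real.exp t * (frequency μ lam g h p t + finrank ℝ E))
      (Real.exp t * (frequency μ lam g h p t + finrank ℝ E) + Real.exp t *
        (1 * (ballEnergy μ lam g h p t / sphereMass μ g h p t) +
          t * ((surfInt μ (energyDensity lam g h) p t * sphereMass μ g h p t -
            ballEnergy μ lam g h p t * ((finrank ℝ E - 1) / t * sphereMass μ g h p t
              + 2 * ballEnergy μ lam g h p t)) / sphereMass μ g h p t ^ 2))) t := fun t ht => by
    have ht0 := hr.trans_le ht.1
    have St := S.mono (ball_subset_ball (ht.2.trans hsR))
    exact (Real.hasDerivAt_exp t).mul (((hasDerivAt_id t).mul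
      ((St.hasDerivAt_ballEnergy μ ht0).div (St.hasDerivAt_sphereMass μ ht0) (hH t ht).ne')).add_const _)
  have hmono := monotoneOn_of_hasDerivWithinAt_nonneg (convex_Icc r s)
    (fun t ht => (hd t ht).continuousAt.continuousWithinAt)
    (fun t ht => (hd t (interior_subset ht)).hasDerivWithinAt) fun t ht => by
      have ht := interior_subset ht
      have ht0 := hr.trans_le ht.1
      have St := S.mono (ball_subset_ball (ht.2.trans hsR))
      have ht1 := (ht.2.trans hsR).trans hR
      have := frequency_deriv_bound ht0 ht1 (Nat.cast_nonneg _) (hH t ht)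
        (St.mul_deriv_ballEnergy_ge μ hlam ht0 ht1 hm) (St.sq_mul_ballEnergy_le μ ht0)
      rw [← mul_add, one_mul]
      exact mul_nonneg (Real.exp_pos t).le this
  have h1 := hmono (left_mem_Icc.2 hrs) (right_mem_Icc.2 hrs) hrs
  simp only at h1
  have hs0 := (S.mono (ball_subset_ball hsR)).frequency_add_nonneg μ hlam (hr.trans_le hrs) (hsR.trans hR)
  have hr0 := (S.mono (ball_subset_ball (hrs.trans hsR))).frequency_add_nonneg μ hlam hr ((hrs.trans hsR).trans hR)
  have e1 : 1 ≤ Real.exp r := Real.one_le_exp hr.le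
  have e2 : Real.exp s ≤ 3 := (Real.exp_le_exp.2 (hsR.trans hR)).trans Real.exp_one_lt_three.le
  calc _ ≤ Real.exp r * (frequency μ lam g h p r + finrank ℝ E) := le_mul_of_one_le_left hr0 e1
    _ ≤ _ := h1
    _ ≤ _ := mul_le_mul_of_nonneg_right e2 hs0

/-- A zero of the nonnegative function `H` is a minimum, so `H' = 2D` vanishes there. This covers
the degenerate radii in the doubling estimate. -/
theorem ballEnergy_eq_zero (S : CoupledSystem lam g h (ball p r)) (hr : 0 < r)
    (h0 : sphereMass μ g h p r = 0) : ballEnergy μ lam g h p r = 0 := by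
  have hmin : IsLocalMin (sphereMass μ g h p) r := by
    filter_upwards [lt_mem_nhds hr] with t ht
    rw [h0]
    exact sphereMass_nonneg μ g h p ht.le
  have := hmin.hasDerivAt_eq_zero (S.hasDerivAt_sphereMass μ hr)
  rw [h0] at this
  linarith

/-- The sign of this derivative is that of `rD - βH`, so a frequency bound by `β` translates into
growth of `H` compared with the power `m - 1 + 2β`, with no division by `H`. -/
theorem hasDerivAt_sphereMass_mul_rpow (S : CoupledSystem lam g h (ball p r)) (hr : 0 < r) (β : ℝ) :
    HasDerivAt (fun t => sphereMass μ g h p t * t ^ (-(finrank ℝ E - 1 + 2 * β)))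
      (2 * (r * ballEnergy μ lam g h p r - β * sphereMass μ g h p r) *
        (r ^ (-(finrank ℝ E - 1 + 2 * β)) / r)) r := by
  refine ((S.hasDerivAt_sphereMass μ hr).mul
    (Real.hasDerivAt_rpow_const (p := -(finrank ℝ E - 1 + 2 * β)) (Or.inl hr.ne'))).congr_deriv ?_
  rw [Real.rpow_sub_one hr.ne']
  field_simp
  ring

theorem sphereMass_le_mul_rpow (S : CoupledSystem lam g h (ball p s)) {β : ℝ} (hr : 0 < r)
    (hrs : r ≤ s)
    (hβ : ∀ t ∈ Icc r s, t * ballEnergy μ lam g h p t ≤ β * sphereMass μ g h p t) :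
    sphereMass μ g h p s ≤ sphereMass μ g h p r * (s / r) ^ (finrank ℝ E - 1 + 2 * β) := by
  have hd := fun t (ht : t ∈ Icc r s) =>
    (S.mono (ball_subset_ball ht.2)).hasDerivAt_sphereMass_mul_rpow μ (hr.trans_le ht.1) β
  have h1 := antitoneOn_of_hasDerivWithinAt_nonpos (convex_Icc r s)
    (fun t ht => (hd t ht).continuousAt.continuousWithinAt)
    (fun t ht => (hd t (interior_subset ht)).hasDerivWithinAt) (fun t ht => by
      have ht := interior_subset ht
      have ht0 := hr.trans_le ht.1
      have := hβ t ht
      exact mul_nonpos_of_nonpos_of_nonneg (by linarith) (by positivity))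
    (left_mem_Icc.2 hrs) (right_mem_Icc.2 hrs) hrs
  simp only at h1
  have hs := hr.trans_le hrs
  rw [Real.rpow_neg hr.le, Real.rpow_neg hs.le, ← div_eq_mul_inv, ← div_eq_mul_inv,
    div_le_div_iff₀ (by positivity) (by positivity)] at h1
  rw [Real.div_rpow hs.le hr.le, ← mul_div_assoc, le_div_iff₀ (by positivity)]
  exact h1

theorem mul_rpow_le_sphereMass (S : CoupledSystem lam g h (ball p s)) {β : ℝ} (hr : 0 < r)
    (hrs : r ≤ s)
    (hβ : ∀ t ∈ Icc r s, β * sphereMass μ g h p t ≤ t * ballEnergy μ lam g h p t) :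
    sphereMass μ g h p r * (s / r) ^ (finrank ℝ E - 1 + 2 * β) ≤ sphereMass μ g h p s := by
  have hd := fun t (ht : t ∈ Icc r s) =>
    (S.mono (ball_subset_ball ht.2)).hasDerivAt_sphereMass_mul_rpow μ (hr.trans_le ht.1) β
  have h1 := monotoneOn_of_hasDerivWithinAt_nonneg (convex_Icc r s)
    (fun t ht => (hd t ht).continuousAt.continuousWithinAt)
    (fun t ht => (hd t (interior_subset ht)).hasDerivWithinAt) (fun t ht => by
      have ht := interior_subset ht
      have ht0 := hr.trans_le ht.1
      have := hβ t ht
      exact mul_nonneg (by linarith) (by positivity))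
    (left_mem_Icc.2 hrs) (right_mem_Icc.2 hrs) hrs
  simp only at h1
  have hs := hr.trans_le hrs
  rw [Real.rpow_neg hr.le, Real.rpow_neg hs.le, ← div_eq_mul_inv, ← div_eq_mul_inv,
    div_le_div_iff₀ (by positivity) (by positivity)] at h1
  rw [Real.div_rpow hs.le hr.le, ← mul_div_assoc, div_le_iff₀ (by positivity)]
  exact h1

/-- Doubling estimate. -/
theorem sphereMass_le_of_frequency (S : CoupledSystem lam g h (ball p R)) (hlam : 1 ≤ lam)
    (hR : R ≤ 1) (hm : 2 ≤ finrank ℝ E) (hr : 0 < r) (hrR : r ≤ R) :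
    sphereMass μ g h p R ≤ sphereMass μ g h p r * (R / r) ^
      (finrank ℝ E - 1 + 2 * (3 * (frequency μ lam g h p R + finrank ℝ E))) := by
  refine S.sphereMass_le_mul_rpow μ hr hrR fun t ht => ?_
  have ht0 := hr.trans_le ht.1
  rcases (sphereMass_nonneg μ g h p ht0.le).eq_or_lt with h0 | hpos
  · rw [(S.mono (ball_subset_ball ht.2)).ballEnergy_eq_zero μ ht0 h0.symm, ← h0]; simp
  · have h1 := S.frequency_add_le μ hlam hR hm ht0 ht.2 le_rfl hpos
    have h2 : frequency μ lam g h p t ≤ 3 * (frequency μ lam g h p R + finrank ℝ E) :=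
      (le_add_of_nonneg_right (Nat.cast_nonneg _)).trans h1
    rw [frequency, ← mul_div_assoc, div_le_iff₀ hpos] at h2
    exact h2

/-- Together with `le_setIntegral_ball` this passes between spheres and solid balls. Only the solid
integrals are monotone under inclusion of balls with different centres. -/
theorem setIntegral_ball_le (S : CoupledSystem lam g h (ball p R)) (hlam : 1 ≤ lam)
    (hR : R ≤ 1) (hm : 2 ≤ finrank ℝ E) (hR0 : 0 < R) :
    ∫ x in ball p R, (g x ^ 2 + h x ^ 2) ∂μ ≤ R * sphereMass μ g h p R := by
  have hgc := S.1.continuous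
  have hhc := S.2.continuous
  have hc := S.continuous_sphereMass μ
  rw [setIntegral_ball_eq μ (by fun_prop) p hR0.le]
  calc _ ≤ ∫ _ in (0)..R, sphereMass μ g h p R :=
        intervalIntegral.integral_mono_on_of_le_Ioo hR0.le (hc.intervalIntegrable _ _) (by simp)
          fun t ht => S.monotoneOn_sphereMass μ hlam hR hm ⟨ht.1, ht.2.le⟩ ⟨hR0, le_rfl⟩ ht.2.le
    _ = _ := by simp

theorem le_setIntegral_ball (S : CoupledSystem lam g h (ball p R)) (hlam : 1 ≤ lam)
    (hR : R ≤ 1) (hm : 2 ≤ finrank ℝ E) (hr : 0 < r) (hrR : r ≤ R) :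
    (R - r) * sphereMass μ g h p r ≤ ∫ x in ball p R, (g x ^ 2 + h x ^ 2) ∂μ := by
  have hgc := S.1.continuous
  have hhc := S.2.continuous
  have hc := S.continuous_sphereMass μ
  rw [setIntegral_ball_eq μ (by fun_prop) p (hr.le.trans hrR)]
  change _ ≤ ∫ t in (0)..R, sphereMass μ g h p t
  rw [← intervalIntegral.integral_add_adjacent_intervals (hc.intervalIntegrable 0 r)
    (hc.intervalIntegrable r R)]
  have h1 : 0 ≤ ∫ t in (0)..r, sphereMass μ g h p t :=
    intervalIntegral.integral_nonneg hr.le fun t ht => sphereMass_nonneg μ g h p ht.1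
  have h2 : ∫ _ in r..R, sphereMass μ g h p r ≤ ∫ t in r..R, sphereMass μ g h p t :=
    intervalIntegral.integral_mono_on hrR (by simp) (hc.intervalIntegrable _ _)
      fun t ht => S.monotoneOn_sphereMass μ hlam hR hm ⟨hr, hrR⟩ ⟨hr.trans_le ht.1, ht.2⟩ ht.1
  simp only [intervalIntegral.integral_const, smul_eq_mul] at h2
  linarith

/-- Uses `32 ≤ (3/2)^9` and `16 ≤ (3/2)^7`. -/
theorem exponent_le_of_rpow_le {j k : ℝ} (hk : 0 ≤ k)
    (h : (3 / 2 : ℝ) ^ j ≤ 32 * 16 ^ k) : j ≤ 9 + 7 * k := by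
  have h1 : (16 : ℝ) ^ k ≤ (3 / 2 : ℝ) ^ (7 * k) := by
    rw [Real.rpow_mul (by norm_num)]
    exact Real.rpow_le_rpow (by norm_num) (by norm_num) hk
  have h2 : (32 : ℝ) ≤ (3 / 2 : ℝ) ^ (9 : ℝ) := by norm_num
  have h3 : (3 / 2 : ℝ) ^ j ≤ (3 / 2 : ℝ) ^ (9 + 7 * k) := by
    rw [Real.rpow_add (by norm_num)]
    exact h.trans (mul_le_mul h2 h1 (by positivity) (by positivity))
  exact (Real.rpow_le_rpow_left_iff (by norm_num)).1 h3

/-- Change of centre for the frequency. -/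
theorem frequency_le_of_center (S : CoupledSystem lam g h (ball (0 : E) R)) (hlam : 1 ≤ lam)
    (hR0 : 0 < R) (hR : R ≤ 1) (hm : 2 ≤ finrank ℝ E) (hp : ‖p‖ < R / 4) (hr : 0 < r)
    (hrR : r ≤ (R - ‖p‖) / 2) :
    frequency μ lam g h p r ≤
      36 * finrank ℝ E + 15 + 189 * (frequency μ lam g h 0 R + finrank ℝ E) := by
  set m : ℝ := (finrank ℝ E : ℝ) with hmdef
  set Q := frequency μ lam g h 0 R + m with hQ
  have hQ0 : 0 ≤ Q := S.frequency_add_nonneg μ hlam hR0 hR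
  have hm0 : 2 ≤ m := by rw [hmdef]; exact_mod_cast hm
  rcases (sphereMass_nonneg μ g h p hr.le).eq_or_lt with h0 | hpos
  · rw [frequency, ← h0]
    simp only [div_zero, mul_zero]
    positivity
  have hgc := S.1.continuous
  have hhc := S.2.continuous
  have hp0 := norm_nonneg p
  -- The largest admissible radius. The ball of radius `2δ` about `p` still lies in `B_R(0)`, which
  -- leaves room to measure growth from `δ` to `3δ/2`.
  set δ := (R - ‖p‖) / 2 with hδ
  have hδ0 : 0 < δ := hr.trans_le hrR
  have hsub : ball p (2 * δ) ⊆ ball 0 R := ball_subset_ball' (by rw [dist_zero_right]; linarith)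
  have Sp : CoupledSystem lam g h (ball p (2 * δ)) := S.mono hsub
  have h2δ : 2 * δ ≤ 1 := by linarith
  have hδpos : 0 < sphereMass μ g h p δ := hpos.trans_le <|
    Sp.monotoneOn_sphereMass μ hlam h2δ hm ⟨hr, by linarith⟩ ⟨hδ0, by linarith⟩ hrR
  set A := frequency μ lam g h p δ + m with hA
  have hVmono : ∀ {s t : Set E}, s ⊆ t → Bornology.IsBounded t →
      ∫ x in s, (g x ^ 2 + h x ^ 2) ∂μ ≤ ∫ x in t, (g x ^ 2 + h x ^ 2) ∂μ := fun hst ht => by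
    obtain ⟨ρ, hρ⟩ := ht.subset_closedBall 0
    refine setIntegral_mono_set ?_ (Filter.Eventually.of_forall fun x => by positivity) hst.eventuallyLE
    exact (Continuous.continuousOn (by fun_prop)).integrableOn_compact (isCompact_closedBall 0 ρ) |>.mono_set hρ
  have u1 : (2 * δ - 3 / 2 * δ) * sphereMass μ g h p (3 / 2 * δ) ≤ R * sphereMass μ g h 0 R :=
    (Sp.le_setIntegral_ball μ hlam h2δ hm (by positivity) (by linarith)).trans
      ((hVmono hsub isBounded_ball).trans (S.setIntegral_ball_le μ hlam hR hm hR0))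
  -- The inclusion `B_{R/8}(0) ⊆ B_δ(p)` is where `‖p‖ < R/4` enters.
  have u2 : (R / 8 - R / 16) * sphereMass μ g h 0 (R / 16) ≤ δ * sphereMass μ g h p δ :=
    ((S.mono (ball_subset_ball (by linarith))).le_setIntegral_ball μ hlam (by linarith) hm
      (by positivity) (by linarith)).trans
      ((hVmono (ball_subset_ball' (by rw [dist_zero_left]; linarith)) isBounded_ball).trans
        ((Sp.mono (ball_subset_ball (by linarith))).setIntegral_ball_le μ hlam (by linarith) hm hδ0))
  have u3 := S.sphereMass_le_of_frequency μ hlam hR hm (r := R / 16) (by positivity) (by linarith)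
  rw [show R / (R / 16) = 16 by field_simp] at u3
  -- Almost monotonicity read outwards: `A ≤ 3(N(p, t) + m)` for `t ≥ δ`, so `A/3 - m` is a lower
  -- bound for the frequency on `[δ, 3δ/2]`.
  have u4 := (Sp.mono (ball_subset_ball (by linarith : 3 / 2 * δ ≤ 2 * δ))).mul_rpow_le_sphereMass μ
    (β := A / 3 - m) hδ0 (by linarith) fun t ht => by
      have htpos : 0 < sphereMass μ g h p t := hδpos.trans_le <|
        Sp.monotoneOn_sphereMass μ hlam h2δ hm ⟨hδ0, by linarith⟩
          ⟨hδ0.trans_le ht.1, by linarith [ht.2]⟩ ht.1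
      have h1 := Sp.frequency_add_le μ hlam h2δ hm hδ0 ht.1 (by linarith [ht.2]) hδpos
      have h2 : A / 3 - m ≤ frequency μ lam g h p t := by
        rw [← hmdef] at h1
        linarith
      rwa [frequency, ← mul_div_assoc, le_div_iff₀ htpos] at h2
  rw [show 3 / 2 * δ / δ = 3 / 2 by field_simp] at u4
  have u5 := Sp.frequency_add_le μ hlam h2δ hm hr hrR (by linarith) hpos
  rw [← hmdef] at u3 u4 u5
  rw [← hQ] at u3
  rw [← hA] at u5
  set k := m - 1 + 2 * (3 * Q)
  set j := m - 1 + 2 * (A / 3 - m)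
  have hk : 0 ≤ k := by simp only [k]; linarith
  have hRδ : R * (sphereMass μ g h 0 (R / 16)) ≤ 16 * δ * sphereMass μ g h p δ := by linarith
  -- Lower growth about `p` against upper growth about `0`; the common factor `δ/2 · H(p, δ)` is
  -- positive and cancels.
  have u6 : (3 / 2 : ℝ) ^ j ≤ 32 * 16 ^ k := by
    have v1 : δ / 2 * (sphereMass μ g h p δ * (3 / 2 : ℝ) ^ j) ≤
        δ / 2 * sphereMass μ g h p (3 / 2 * δ) := by gcongr
    have v2 : R * sphereMass μ g h 0 R ≤ R * (sphereMass μ g h 0 (R / 16) * 16 ^ k) := by gcongr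
    have v3 : R * sphereMass μ g h 0 (R / 16) * 16 ^ k ≤ 16 * δ * sphereMass μ g h p δ * 16 ^ k := by
      gcongr
    have v4 : (δ / 2 * sphereMass μ g h p δ) * (3 / 2 : ℝ) ^ j ≤
        (δ / 2 * sphereMass μ g h p δ) * (32 * 16 ^ k) := by linarith
    exact le_of_mul_le_mul_left v4 (by positivity)
  have u7 := exponent_le_of_rpow_le hk u6
  simp only [k, j] at u7
  linarith

end CoupledSystem
end FrequencyMonotonicity

/-! ### Lifting to one more dimension, localisation and the final constant. -/

namespace BiharmonicFrequency

open MeasureTheory Metric Set Module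

/-- The projection `horizontal` as a continuous linear map. -/
noncomputable def horizontalCLM (n : ℕ) :
    EuclideanSpace ℝ (Fin (n + 1)) →L[ℝ] EuclideanSpace ℝ (Fin n) :=
  LinearMap.toContinuousLinearMap
    { toFun := horizontal
      map_add' := fun _ _ => rfl
      map_smul' := fun _ _ => rfl }

variable {n : ℕ} {lam : ℝ}

@[simp]
theorem horizontalCLM_apply (y : EuclideanSpace ℝ (Fin (n + 1))) : horizontalCLM n y = horizontal y := rfl

theorem norm_horizontal_le (y : EuclideanSpace ℝ (Fin (n + 1))) : ‖horizontal y‖ ≤ ‖y‖ := by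
  rw [EuclideanSpace.norm_eq, EuclideanSpace.norm_eq]
  refine Real.sqrt_le_sqrt ?_
  rw [Fin.sum_univ_castSucc]
  exact le_add_of_nonneg_right (by positivity)

theorem expLift_eq (lam : ℝ) (f : EuclideanSpace ℝ (Fin n) → ℝ) :
    expLift lam f = fun y => f (horizontalCLM n y) *
      Real.exp (Real.sqrt lam * EuclideanSpace.proj (𝕜 := ℝ) (Fin.last n) y) := rfl

theorem contDiff_expLift {k : WithTop ℕ∞} {f : EuclideanSpace ℝ (Fin n) → ℝ} (hf : ContDiff ℝ k f) :
    ContDiff ℝ k (expLift lam f) := by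
  rw [expLift_eq]
  have h1 := hf.comp (horizontalCLM n).contDiff
  have h2 : ContDiff ℝ k fun y : EuclideanSpace ℝ (Fin (n + 1)) =>
      Real.sqrt lam * EuclideanSpace.proj (𝕜 := ℝ) (Fin.last n) y :=
    contDiff_const.mul (EuclideanSpace.proj (𝕜 := ℝ) (Fin.last n)).contDiff
  exact h1.mul (Real.contDiff_exp.comp h2)

theorem fderiv_expLift {f : EuclideanSpace ℝ (Fin n) → ℝ} (hf : Differentiable ℝ f)
    (y w : EuclideanSpace ℝ (Fin (n + 1))) :
    fderiv ℝ (expLift lam f) y w =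
      expLift lam (fun x => fderiv ℝ f x (horizontal w)) y +
        Real.sqrt lam * w (Fin.last n) * expLift lam f y := by
  have h1 : HasFDerivAt (fun y => f (horizontalCLM n y))
      ((fderiv ℝ f (horizontalCLM n y)).comp (horizontalCLM n)) y :=
    (hf _).hasFDerivAt.comp y (horizontalCLM n).hasFDerivAt
  have h2 := (((EuclideanSpace.proj (𝕜 := ℝ) (Fin.last n)).hasFDerivAt (x := y)).const_mul
    (Real.sqrt lam)).exp
  have h3 : HasFDerivAt (expLift lam f) _ y := h1.mul h2
  rw [h3.fderiv]
  simp [expLift]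
  ring

/-- The extra variable contributes `(√λ)² = λ`. The mixed term in `hline` vanishes on each basis
vector, which is either horizontal or vertical. -/
theorem laplacian_expLift {f : EuclideanSpace ℝ (Fin n) → ℝ} (hf : ContDiff ℝ 2 f) (hlam : 0 ≤ lam)
    (y : EuclideanSpace ℝ (Fin (n + 1))) :
    (Δ (expLift lam f)) y = expLift lam (Δ f) y + lam * expLift lam f y := by
  have hf1 : Differentiable ℝ f := hf.differentiable two_ne_zero
  have second : ∀ {m : ℕ} {F : EuclideanSpace ℝ (Fin m) → ℝ}, ContDiff ℝ 2 F → ∀ x w,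
      fderiv ℝ (fderiv ℝ F) x w w = fderiv ℝ (fun z => fderiv ℝ F z w) x w := fun hF x w => by
    rw [fderiv_clm_apply (((hF.fderiv_right (m := 1) le_rfl).differentiable one_ne_zero) x)
      (differentiableAt_const w)]
    simp
  have hderiv : ∀ v, Differentiable ℝ fun x => fderiv ℝ f x v := fun v =>
    ((hf.fderiv_right (m := 1) le_rfl).clm_apply contDiff_const).differentiable one_ne_zero
  have hlift : ∀ {f : EuclideanSpace ℝ (Fin n) → ℝ}, ContDiff ℝ 1 f → Differentiable ℝ (expLift lam f) :=
    fun h => (contDiff_expLift h).differentiable one_ne_zero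
  have hline : ∀ w, fderiv ℝ (fderiv ℝ (expLift lam f)) y w w =
      expLift lam (fun x => fderiv ℝ (fderiv ℝ f) x (horizontal w) (horizontal w)) y +
        2 * Real.sqrt lam * w (Fin.last n) * expLift lam (fun x => fderiv ℝ f x (horizontal w)) y +
        lam * w (Fin.last n) ^ 2 * expLift lam f y := fun w => by
    rw [second (contDiff_expLift hf)]
    simp_rw [fderiv_expLift hf1, second hf]
    have d1 : DifferentiableAt ℝ (expLift lam fun x => fderiv ℝ f x (horizontal w)) y :=
      hlift ((hf.fderiv_right (m := 1) le_rfl).clm_apply contDiff_const) y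
    have d2 : DifferentiableAt ℝ (expLift lam f) y := hlift (hf.of_le one_le_two) y
    rw [fderiv_fun_add d1 (d2.const_mul _), fderiv_const_mul d2]
    simp only [add_apply, smul_apply, smul_eq_mul, fderiv_expLift (hderiv _), fderiv_expLift hf1]
    linear_combination w (Fin.last n) ^ 2 * expLift lam f y * Real.mul_self_sqrt hlam
  rw [laplacian_eq_sum (EuclideanSpace.basisFun (Fin (n + 1)) ℝ), Fin.sum_univ_castSucc]
  have hcast : ∀ i : Fin n, horizontal (EuclideanSpace.basisFun (Fin (n + 1)) ℝ i.castSucc) =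
      EuclideanSpace.basisFun (Fin n) ℝ i := fun i => by
    ext j
    simp [horizontal, EuclideanSpace.basisFun_apply]
  have hlast : horizontal (EuclideanSpace.basisFun (Fin (n + 1)) ℝ (Fin.last n)) = 0 := by
    ext j
    simp [horizontal, EuclideanSpace.basisFun_apply]
  have hcl : ∀ i : Fin n, (EuclideanSpace.basisFun (Fin (n + 1)) ℝ i.castSucc) (Fin.last n) = 0 := fun i => by
    simp [EuclideanSpace.basisFun_apply]
  have hll : (EuclideanSpace.basisFun (Fin (n + 1)) ℝ (Fin.last n)) (Fin.last n) = 1 := by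
    simp [EuclideanSpace.basisFun_apply]
  simp_rw [hline, hcast, hlast, hcl, hll]
  simp only [expLift, map_zero, laplacian_eq_sum (EuclideanSpace.basisFun (Fin n) ℝ), Finset.sum_mul]
  simp

theorem contDiff_laplacian {u : EuclideanSpace ℝ (Fin n) → ℝ} (hu : ContDiff ℝ 4 u) :
    ContDiff ℝ 2 (Δ u) := by
  have h1 : ContDiff ℝ 3 (fderiv ℝ u) := hu.fderiv_right (by norm_num)
  have h2 : ContDiff ℝ 2 (fderiv ℝ (fderiv ℝ u)) := h1.fderiv_right (by norm_num)
  rw [show Δ u = fun x => ∑ i, fderiv ℝ (fderiv ℝ u) x (EuclideanSpace.basisFun (Fin n) ℝ i)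
    (EuclideanSpace.basisFun (Fin n) ℝ i) from funext fun x => laplacian_eq_sum _ u x]
  exact ContDiff.sum fun i _ => (h2.clm_apply contDiff_const).clm_apply contDiff_const

theorem contDiff_auxV {u : EuclideanSpace ℝ (Fin n) → ℝ} (hu : ContDiff ℝ 4 u) :
    ContDiff ℝ 2 (auxV lam u) :=
  (contDiff_laplacian hu).sub (contDiff_const.mul (hu.of_le (by norm_num)))

/-- The second order system satisfied by `g` and `h`. -/
theorem coupledSystem {u : EuclideanSpace ℝ (Fin n) → ℝ} (hu : ContDiff ℝ 4 u) (hlam : 0 ≤ lam)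
    {r : ℝ} (heq : ∀ x ∈ ball (0 : EuclideanSpace ℝ (Fin n)) r, (Δ (Δ u)) x = lam ^ 2 * u x) :
    CoupledSystem lam (g lam u) (h lam u) (ball 0 r) where
  contDiff_left := contDiff_expLift (hu.of_le (by norm_num))
  contDiff_right := contDiff_expLift (contDiff_auxV hu)
  laplacian_left y _ := by
    rw [g, laplacian_expLift (hu.of_le (by norm_num)) hlam]
    simp only [h, expLift, auxV]
    ring
  laplacian_right y hy := by
    have hy' : horizontal y ∈ ball (0 : EuclideanSpace ℝ (Fin n)) r := by
      rw [mem_ball_zero_iff] at hy ⊢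
      exact (norm_horizontal_le y).trans_lt hy
    have hu2 : ContDiffAt ℝ 2 u (horizontal y) := (hu.of_le (by norm_num)).contDiffAt
    -- The factorisation `(Δ + λ)(Δ - λ)u = Δ²u - λ²u = 0`.
    have h1 : (Δ (auxV lam u)) (horizontal y) = -(lam * auxV lam u (horizontal y)) := by
      have : auxV lam u = Δ u - lam • u := rfl
      rw [this, (contDiff_laplacian hu).contDiffAt.laplacian_sub (f₂ := lam • u) (hu2.const_smul lam),
        InnerProductSpace.laplacian_smul _ hu2, heq _ hy']
      simp
      ring
    rw [h, laplacian_expLift (contDiff_auxV hu) hlam]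
    simp only [expLift, h1]
    ring

theorem H_eq_sphereMass {u : EuclideanSpace ℝ (Fin n) → ℝ} (hg : Continuous (g lam u))
    (hh : Continuous (h lam u)) (p : EuclideanSpace ℝ (Fin (n + 1))) {r : ℝ} (hr : 0 ≤ r) :
    H lam u p r = sphereMass volume (g lam u) (h lam u) p r := by
  rw [H, sphereMeasure, integral_smul_measure, integral_map, sphereMass, surfInt,
    ENNReal.toReal_ofReal (by positivity), finrank_euclideanSpace_fin, smul_eq_mul]
  · exact (by fun_prop : Continuous fun ω : sphere (0 : EuclideanSpace ℝ (Fin (n + 1))) 1 =>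
      p + r • (ω : EuclideanSpace ℝ (Fin (n + 1)))).aemeasurable
  · exact (by fun_prop : Continuous fun y => g lam u y ^ 2 + h lam u y ^ 2).aestronglyMeasurable

theorem N_eq_frequency {u : EuclideanSpace ℝ (Fin n) → ℝ} (hg : Continuous (g lam u))
    (hh : Continuous (h lam u)) (p : EuclideanSpace ℝ (Fin (n + 1))) {r : ℝ} (hr : 0 ≤ r) :
    N lam u p r = frequency volume lam (g lam u) (h lam u) p r := by
  rw [N, frequency, H_eq_sphereMass hg hh p hr]
  rfl

/-- The frequency only depends on `u` near the projection of the ball. -/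
theorem N_congr {u u' : EuclideanSpace ℝ (Fin n) → ℝ} {W : Set (EuclideanSpace ℝ (Fin n))}
    (hW : IsOpen W) (hu : EqOn u u' W) {p : EuclideanSpace ℝ (Fin (n + 1))} {r : ℝ} (hr : 0 ≤ r)
    (hp : closedBall p r ⊆ horizontal ⁻¹' W) : N lam u p r = N lam u' p r := by
  have hO : IsOpen (horizontal ⁻¹' W : Set (EuclideanSpace ℝ (Fin (n + 1)))) :=
    hW.preimage (horizontalCLM n).continuous
  have hv : EqOn (auxV lam u) (auxV lam u') W := fun x hx => by
    have h1 := (InnerProductSpace.laplacian_congr_nhds (hu.eventuallyEq_of_mem (hW.mem_nhds hx))).self_of_nhds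
    simp only [auxV, h1, hu hx]
  have hg : EqOn (g lam u) (g lam u') (horizontal ⁻¹' W) := fun y hy => by
    simp only [g, expLift, hu hy]
  have hh : EqOn (h lam u) (h lam u') (horizontal ⁻¹' W) := fun y hy => by
    simp only [h, expLift, hv hy]
  have hD : D lam u p r = D lam u' p r := by
    refine setIntegral_congr_fun measurableSet_ball fun y hy => ?_
    have hy' := hp (ball_subset_closedBall hy)
    simp only [hg hy', hh hy', (hg.eventuallyEq_of_mem (hO.mem_nhds hy')).gradient_eq,
      (hh.eventuallyEq_of_mem (hO.mem_nhds hy')).gradient_eq]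
  have hH : H lam u p r = H lam u' p r := by
    refine integral_congr_ae ?_
    refine Measure.ae_smul_measure ?_ _
    have hsub : ∀ᵐ y ∂(Measure.map (fun ω : sphere (0 : EuclideanSpace ℝ (Fin (n + 1))) 1 =>
        p + r • (ω : EuclideanSpace ℝ (Fin (n + 1))))
        (volume : Measure (EuclideanSpace ℝ (Fin (n + 1)))).toSphere), y ∈ horizontal ⁻¹' W := by
      refine (ae_map_iff (by fun_prop : Continuous fun ω : sphere (0 : EuclideanSpace ℝ (Fin (n + 1))) 1 =>
        p + r • (ω : EuclideanSpace ℝ (Fin (n + 1)))).aemeasurable hO.measurableSet).2 ?_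
      refine Filter.Eventually.of_forall fun ω => hp ?_
      rw [mem_closedBall, dist_eq_norm, add_sub_cancel_left, norm_smul, norm_eq_of_mem_sphere,
        mul_one, Real.norm_of_nonneg hr]
    filter_upwards [hsub] with y hy
    simp only [hg hy, hh hy]
  rw [N, N, hD, hH]

/-- The identities above need functions smooth on the whole space, so `u` is multiplied by a bump
function. Agreement on an open neighbourhood of the closed ball preserves all derivatives there, and
hence the frequencies and the equation. -/
theorem exists_contDiff_eqOn {u : EuclideanSpace ℝ (Fin n) → ℝ} {U : Set (EuclideanSpace ℝ (Fin n))}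
    (hU : IsOpen U) {r : ℝ} (hr : 0 < r) (hrU : closedBall 0 r ⊆ U) (hu : ContDiffOn ℝ 4 u U) :
    ∃ (u' : EuclideanSpace ℝ (Fin n) → ℝ) (W : Set (EuclideanSpace ℝ (Fin n))),
      ContDiff ℝ 4 u' ∧ IsOpen W ∧ closedBall 0 r ⊆ W ∧ EqOn u u' W := by
  obtain ⟨δ, hδ, hδU⟩ := (isCompact_closedBall (0 : EuclideanSpace ℝ (Fin n)) r).exists_cthickening_subset_open hU hrU
  rw [cthickening_closedBall hδ.le hr.le] at hδU
  let χ : ContDiffBump (0 : EuclideanSpace ℝ (Fin n)) :=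
    ⟨r + δ / 2, r + δ, by positivity, by linarith⟩
  have hts : tsupport χ ⊆ U := by
    rw [χ.tsupport_eq]
    simpa [χ, add_comm] using hδU
  refine ⟨fun x => χ x * u x, ball 0 (r + δ / 2), ?_, isOpen_ball,
    closedBall_subset_ball (by linarith), fun x hx => ?_⟩
  · rw [contDiff_iff_contDiffAt]
    intro x
    by_cases hx : x ∈ tsupport χ
    · exact χ.contDiff.contDiffAt.mul (hu.contDiffAt (hU.mem_nhds (hts hx)))
    · refine (contDiffAt_const (c := (0 : ℝ))).congr_of_eventuallyEq ?_
      filter_upwards [notMem_tsupport_iff_eventuallyEq.1 hx] with z hz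
      rw [hz]; simp
  · have : χ x = 1 := χ.one_of_mem_closedBall (ball_subset_closedBall hx)
    simp [this]

end BiharmonicFrequency

open BiharmonicFrequency in
theorem theorem3p5 (n : ℕ) (hn : 2 ≤ n) (C₀ : ℝ) (hC₀ : 0 < C₀) :
    ∃ C : ℝ, 0 < C ∧
      ∀ (lam r₀ : ℝ), 1 < lam → 0 < r₀ → r₀ < 1 →
      ∀ (U : Set (EuclideanSpace ℝ (Fin n))), IsOpen U → Metric.closedBall 0 r₀ ⊆ U →
      ∀ u : EuclideanSpace ℝ (Fin n) → ℝ, ContDiffOn ℝ 4 u U →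
      (∀ x ∈ Metric.ball (0 : EuclideanSpace ℝ (Fin n)) r₀, (Δ (Δ u)) x = lam ^ 2 * u x) →
      ∀ p ∈ Metric.ball (0 : EuclideanSpace ℝ (Fin (n + 1))) (r₀ / 4),
      ∀ ρ : ℝ, 0 < ρ → ρ ≤ (r₀ - ‖p‖) / 2 →
        BiharmonicFrequency.N lam u p ρ ≤ C * max (BiharmonicFrequency.N lam u 0 r₀) C₀ := by
  -- With dimension `n + 1`, the change of centre gives `36(n + 1) + 15 + 189(N(0, r₀) + n + 1)`.
  -- The constant part is at most its quotient by `C₀` times the maximum.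
  refine ⟨(225 * (n + 1) + 15) / C₀ + 189, by positivity, ?_⟩
  intro lam r₀ hlam hr₀ hr₀1 U hU hrU u hu heq p hp ρ hρ hρr
  obtain ⟨u', W, hu', hW, hrW, huW⟩ := exists_contDiff_eqOn hU hr₀ hrU hu
  have heq' : ∀ x ∈ Metric.ball (0 : EuclideanSpace ℝ (Fin n)) r₀, (Δ (Δ u')) x = lam ^ 2 * u' x := by
    intro x hx
    have hxW := hrW (Metric.ball_subset_closedBall hx)
    have h1 := InnerProductSpace.laplacian_congr_nhds (huW.eventuallyEq_of_mem (hW.mem_nhds hxW))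
    rw [← (InnerProductSpace.laplacian_congr_nhds h1).self_of_nhds, heq x hx, huW hxW]
  have S := coupledSystem hu' (zero_le_one.trans hlam.le) heq'
  have hp' : ‖p‖ < r₀ / 4 := by simpa using hp
  have hcyl : Metric.closedBall (0 : EuclideanSpace ℝ (Fin (n + 1))) r₀ ⊆ horizontal ⁻¹' W := fun y hy => by
    refine hrW ?_
    rw [mem_closedBall_zero_iff] at hy ⊢
    exact (norm_horizontal_le y).trans hy
  have hsub : Metric.closedBall p ρ ⊆ Metric.closedBall 0 r₀ :=
    Metric.closedBall_subset_closedBall' (by rw [dist_zero_right]; linarith [norm_nonneg p])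
  have hgc := S.1.continuous
  have hhc := S.2.continuous
  rw [N_congr hW huW hρ.le (hsub.trans hcyl), N_congr hW huW hr₀.le hcyl,
    N_eq_frequency hgc hhc p hρ.le, N_eq_frequency hgc hhc 0 hr₀.le]
  have key := S.frequency_le_of_center MeasureTheory.volume hlam.le hr₀ hr₀1.le
    (by rw [finrank_euclideanSpace_fin]; omega) hp' hρ hρr
  rw [finrank_euclideanSpace_fin] at key
  push_cast at key
  set F := frequency MeasureTheory.volume lam (g lam u') (h lam u') 0 r₀
  have h1 : F ≤ max F C₀ := le_max_left _ _
  have h2 : C₀ ≤ max F C₀ := le_max_right _ _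
  have h3 : 225 * ((n : ℝ) + 1) + 15 ≤ (225 * (n + 1) + 15) / C₀ * max F C₀ := by
    rw [div_mul_eq_mul_div, le_div_iff₀ hC₀]
    gcongr
  linarith
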